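/- Let $\overline M$ be a connected (Hausdorff) real-analytic manifold with boundary $\partial M$, of dimension $n\ge 2$. An *analytic projective structure* $[\nabla]$ on $\overline M$ is a full class of projectively equivalent torsion-free affine connections on $T\overline M$ that are analytic up to the boundary (in every analytic chart the components of the connection form are analytic, also at boundary points); here $\nabla$ and $\hat\nabla$ are *projectively equivalent* if there is a one-form $\Upsilon$ such that $\hat\nabla_XY=\nabla_XY+\Upsilon(X)Y+\Upsilon(Y)X$ for all vector fields $X,Y$. A *projective transformation* of $(\overline M,[\nabla])$ is a ($C^\infty$) diffeomorphism $\phi:\overline M\to\overline M$ such that $\phi^*\nabla$ is projectively equivalent to $\nabla$ for the connections $\nabla\in[\nabla]$. The boundary is *rigid* if the only projective transformation $\phi$ with $\phi|_{\partial M}=\mathrm{id}_{\partial M}$ is the identity map of $\overline M$. For a boundary chart with coordinates $(x^0,x^1,\dots,x^{n-1})=(r,y^1,\dots,y^{n-1})$, where $r\ge 0$ and $\partial M$ is given by $r=0$, the local connection form $(\alpha^i_j)$ of $\nabla$ is the matrix of one-forms defined by $\nabla_X\partial_{x^j}=\sum_i\alpha^i_j(X)\,\partial_{x^i}$. **Theorem.**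 Let $\overline M$ be as above, endowed with an analytic projective structure $[\nabla]$. Suppose that there exist a boundary point $p\in\partial M$, a connection in $[\nabla]$, and an analytic boundary chart $(r,y)$ around $p$ mapping $p$ to $(0,0)$, such that the local connection form satisfies $\alpha^0_\nu(p)\notin\operatorname{span}(\mathrm dr(p))$ for at least one $\nu$ with $1\le\nu\le n-1$. Then the boundary $\partial M$ is rigid. -/

import Mathlib

open Set VectorField
open scoped Manifold ContDiff Topology

noncomputable section

namespace ProjBoundary

/-- The model vector space of an `n`-dimensional manifold. -/
abbrev E (n : ℕ) : Type := EuclideanSpace ℝ (Fin n)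

/-- Affine connections on a manifold with boundary `M`: covariant derivatives on `TM`, over the
whole of `M` including its boundary. Here `cov Y x v` is `(∇_v Y)(x)`. -/
abbrev AffineConnection (n : ℕ) [NeZero n] (M : Type*) [TopologicalSpace M]
    [ChartedSpace (EuclideanHalfSpace n) M] [IsManifold (𝓡∂ n) ω M] :=
  CovariantDerivative (𝓡∂ n) (E n) (TangentSpace (𝓡∂ n) : M → Type _)

section

variable {n : ℕ} [NeZero n] {M : Type*} [TopologicalSpace M]
  [ChartedSpace (EuclideanHalfSpace n) M]

/-! ### Coordinates of a chart

A chart is an open partial homeomorphism `e` from `M` to the half space `{x | 0 ≤ x 0}`. Its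
coordinate functions are `x⁰ = r, x¹ = y¹, …, xⁿ⁻¹ = yⁿ⁻¹`, where `r` vanishes exactly on the
boundary. -/

/-- The differential at `x` of the chart `e`, as a linear map `T_x M → ℝⁿ`. -/
def chartDifferential (e : OpenPartialHomeomorph M (EuclideanHalfSpace n)) (x : M) :
    TangentSpace (𝓡∂ n) x →L[ℝ] E n :=
  mvfderiv (𝓡∂ n) (e.extend (𝓡∂ n)) x

/-- The differential `dxⁱ` at `x` of the `i`-th coordinate function of the chart `e`. -/
def coordDifferential (e : OpenPartialHomeomorph M (EuclideanHalfSpace n)) (i : Fin n) (x : M) :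
    TangentSpace (𝓡∂ n) x →L[ℝ] ℝ :=
  (EuclideanSpace.proj i).comp (chartDifferential e x)

/-- The coordinate vector field `∂/∂xʲ` of the chart `e`. -/
def coordField (e : OpenPartialHomeomorph M (EuclideanHalfSpace n)) (j : Fin n) :
    Π x : M, TangentSpace (𝓡∂ n) x :=
  fun x ↦ (chartDifferential e x).inverse (EuclideanSpace.single j 1)

/-! ### Action of a diffeomorphism on vector fields -/

/-- The push-forward `φ_* Y` of a vector field by a diffeomorphism. -/
def pushforward (φ : M ≃ₘ⟮𝓡∂ n, 𝓡∂ n⟯ M) (Y : Π x : M, TangentSpace (𝓡∂ n) x) :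
    Π x : M, TangentSpace (𝓡∂ n) x :=
  mpullback (𝓡∂ n) (𝓡∂ n) φ.symm Y

lemma isInvertible_mfderiv (φ : M ≃ₘ⟮𝓡∂ n, 𝓡∂ n⟯ M) (x : M) :
    (mfderiv (𝓡∂ n) (𝓡∂ n) φ x).IsInvertible :=
  ⟨φ.mfderivToContinuousLinearEquiv (by simp) x, rfl⟩

lemma mfderiv_symm_comp (φ : M ≃ₘ⟮𝓡∂ n, 𝓡∂ n⟯ M) (x : M) :
    (mfderiv (𝓡∂ n) (𝓡∂ n) φ.symm (φ x)).comp (mfderiv (𝓡∂ n) (𝓡∂ n) φ x) =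
      ContinuousLinearMap.id ℝ (E n) := by
  have h := mfderiv_comp x (φ.symm.mdifferentiable (by simp) (φ x))
    (φ.mdifferentiable (by simp) x)
  have h2 : (φ.symm ∘ φ : M → M) = id := funext fun y ↦ φ.symm_apply_apply y
  rw [h2, mfderiv_id] at h
  exact h.symm

/-- The push-forward of vector fields is characterised by `(φ_* Y)(φ x) = dφ_x (Y x)`. -/
lemma pushforward_apply (φ : M ≃ₘ⟮𝓡∂ n, 𝓡∂ n⟯ M) (Y : Π x : M, TangentSpace (𝓡∂ n) x) (x : M) :
    pushforward φ Y (φ x) = mfderiv (𝓡∂ n) (𝓡∂ n) φ x (Y x) := by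
  have hY : Y (φ.symm (φ x)) = (Y x : E n) := by
    rw [φ.symm_apply_apply]
  obtain ⟨A, hA⟩ := isInvertible_mfderiv φ.symm (φ x)
  have hc := mfderiv_symm_comp φ x
  change (mfderiv (𝓡∂ n) (𝓡∂ n) φ.symm (φ x)).inverse (Y (φ.symm (φ x))) = _
  rw [← hA] at hc ⊢
  rw [ContinuousLinearMap.inverse_equiv]
  refine (ContinuousLinearEquiv.symm_apply_eq A).2 ?_
  refine hY.trans ?_
  exact (congrArg (fun L : E n →L[ℝ] E n ↦ L (Y x)) hc).symm

/-! ### Connections and projective structures -/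

variable [IsManifold (𝓡∂ n) ω M]

/-- The local connection form `αⁱⱼ` of a connection in the coordinate frame of the chart `e`: the
one-form characterised by `∇_v (∂/∂xʲ) = ∑ᵢ αⁱⱼ(v) ∂/∂xⁱ`. -/
def connectionForm (cov : AffineConnection n M)
    (e : OpenPartialHomeomorph M (EuclideanHalfSpace n)) (i j : Fin n) (x : M) :
    TangentSpace (𝓡∂ n) x →L[ℝ] ℝ :=
  (coordDifferential e i x).comp (cov (coordField e j) x)

/-- The Christoffel symbols `αⁱⱼₖ = αⁱⱼ(∂/∂xᵏ)`. -/
def christoffel (cov : AffineConnection n M)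
    (e : OpenPartialHomeomorph M (EuclideanHalfSpace n)) (i j k : Fin n) (x : M) : ℝ :=
  connectionForm cov e i j x (coordField e k x)

/-- A connection is analytic (up to the boundary) if, in every analytic chart, the components of
the local connection form are analytic functions of the coordinates. -/
def IsAnalyticConnection (cov : AffineConnection n M) : Prop :=
  ∀ e ∈ IsManifold.maximalAtlas (𝓡∂ n) ω M, ∀ i j k : Fin n,
    ContDiffOn ℝ ω (fun z ↦ christoffel cov e i j k ((e.extend (𝓡∂ n)).symm z))
      (e.extend (𝓡∂ n)).target

/-- The vector field `Y`, as a section of the tangent bundle, is differentiable at `x`. -/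
def FieldDifferentiableAt (Y : Π x : M, TangentSpace (𝓡∂ n) x) (x : M) : Prop :=
  MDifferentiableAt (𝓡∂ n) (𝓡∂ n).tangent (fun y ↦ (⟨y, Y y⟩ : TangentBundle (𝓡∂ n) M)) x

/-- Two connections are projectively equivalent if there is a one-form `Υ` with
`∇'_X Y = ∇_X Y + Υ(X) Y + Υ(Y) X`. (No regularity is imposed on `Υ`: it is determined by the
trace of `∇' - ∇`, hence is as regular as the two connections.) -/
def ProjectivelyEquivalent (cov cov' : AffineConnection n M) : Prop :=
  ∃ Υ : Π x : M, TangentSpace (𝓡∂ n) x →L[ℝ] ℝ,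
    ∀ (x : M) (Y : Π x : M, TangentSpace (𝓡∂ n) x), FieldDifferentiableAt Y x →
      ∀ v : TangentSpace (𝓡∂ n) x, cov' Y x v = cov Y x v + Υ x v • Y x + Υ x (Y x) • v

variable (n M) in
/-- An analytic projective structure: a full class of projectively equivalent analytic
torsion-free affine connections. -/
structure AnalyticProjectiveStructure where
  /-- The connections in the class. -/
  connections : Set (AffineConnection n M)
  nonempty : connections.Nonempty
  torsion_eq_zero : ∀ cov ∈ connections, cov.torsion = 0
  analytic : ∀ cov ∈ connections, IsAnalyticConnection cov
  equivalent : ∀ cov ∈ connections, ∀ cov' ∈ connections, ProjectivelyEquivalent cov cov'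
  full : ∀ cov ∈ connections, ∀ cov' : AffineConnection n M, cov'.torsion = 0 →
    IsAnalyticConnection cov' → ProjectivelyEquivalent cov cov' → cov' ∈ connections

/-! ### Pullback of a connection by a diffeomorphism -/

lemma fieldDifferentiableAt_pushforward (φ : M ≃ₘ⟮𝓡∂ n, 𝓡∂ n⟯ M)
    {Y : Π x : M, TangentSpace (𝓡∂ n) x} {x : M} (hY : FieldDifferentiableAt Y x) :
    FieldDifferentiableAt (pushforward φ Y) (φ x) := by
  refine MDifferentiableAt.mpullback_vectorField (n := ∞) ?_ φ.symm.contMDiffAt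
    (isInvertible_mfderiv φ.symm (φ x)) (by norm_cast)
  have h : φ.symm (φ x) = x := φ.symm_apply_apply x
  rw [h]
  exact hY

/-- The pullback connection `φ^*∇`, given by `dφ ((φ^*∇)_v Y) = ∇_{dφ(v)} (φ_* Y)`. -/
def pullback (φ : M ≃ₘ⟮𝓡∂ n, 𝓡∂ n⟯ M) (cov : AffineConnection n M) : AffineConnection n M where
  toFun Y x := (mfderiv (𝓡∂ n) (𝓡∂ n) φ x).inverse ∘L
    cov (pushforward φ Y) (φ x) ∘L mfderiv (𝓡∂ n) (𝓡∂ n) φ x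
  isCovariantDerivativeOnUniv :=
    { add := fun {Y Y' x} hY hY' _ ↦ by
        have h : pushforward φ (Y + Y') = pushforward φ Y + pushforward φ Y' := mpullback_add ..
        rw [h, cov.isCovariantDerivativeOnUniv.add (fieldDifferentiableAt_pushforward φ hY)
          (fieldDifferentiableAt_pushforward φ hY')]
        ext v : 1
        simp
      leibniz := fun {Y g x} hY hg _ ↦ by
        have h : pushforward φ (g • Y) = (g ∘ φ.symm) • pushforward φ Y := mpullback_smul ..
        have hx : φ.symm (φ x) = x := φ.symm_apply_apply x
        have hg0 : MDifferentiableAt (𝓡∂ n) 𝓘(ℝ, ℝ) g (φ.symm (φ x)) := by rw [hx]; exact hg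
        have hs : MDifferentiableAt (𝓡∂ n) (𝓡∂ n) φ.symm (φ x) :=
          φ.symm.mdifferentiable (by simp) (φ x)
        have hg' : MDifferentiableAt (𝓡∂ n) 𝓘(ℝ, ℝ) (g ∘ φ.symm) (φ x) := hg0.comp (φ x) hs
        rw [h, cov.isCovariantDerivativeOnUniv.leibniz
          (fieldDifferentiableAt_pushforward φ hY) hg']
        obtain ⟨A, hA⟩ := isInvertible_mfderiv φ x
        have hgφ : ∀ v, mvfderiv (𝓡∂ n) (g ∘ φ.symm) (φ x) (mfderiv (𝓡∂ n) (𝓡∂ n) φ x v) =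
            mvfderiv (𝓡∂ n) g x v := by
          intro v
          have h1 := mfderiv_comp x hg' (φ.mdifferentiable (by simp) x)
          have h2 : ((g ∘ φ.symm) ∘ φ : M → ℝ) = g :=
            funext fun y ↦ congrArg g (φ.symm_apply_apply y)
          rw [h2] at h1
          exact (congrArg (fun L : E n →L[ℝ] ℝ ↦ L v) h1).symm
        have hpY := pushforward_apply φ Y x
        ext v : 1
        simp only [ContinuousLinearMap.comp_apply, _root_.add_apply,
          _root_.smul_apply, ContinuousLinearMap.smulRight_apply, hgφ, hpY, map_add,
          map_smul, Function.comp_apply, hx]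
        rw [← hA]
        simp }

/-- A projective transformation: a diffeomorphism `φ` of `M` such that `φ^*∇` is projectively
equivalent to `∇` for the connections `∇` of the projective class. -/
def IsProjectiveTransformation (P : AnalyticProjectiveStructure n M)
    (φ : M ≃ₘ⟮𝓡∂ n, 𝓡∂ n⟯ M) : Prop :=
  ∀ cov ∈ P.connections, ProjectivelyEquivalent cov (pullback φ cov)

/-- The boundary is rigid if the only projective transformation that restricts to the identity on
the boundary is the identity. -/
def BoundaryRigid (P : AnalyticProjectiveStructure n M) : Prop :=
  ∀ φ : M ≃ₘ⟮𝓡∂ n, 𝓡∂ n⟯ M, IsProjectiveTransformation P φ →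
    (∀ x ∈ (𝓡∂ n).boundary M, φ x = x) → φ = Diffeomorph.refl (𝓡∂ n) M ∞

end

end ProjBoundary

end

/-! In a chart, let `A` and `B` be the first and second derivatives of a projective transformation
`φ`, and `Γ` the Christoffel symbols. Projectivity becomes a second order equation expressing `B`
through `φ`, `A` and a one-form `Υ` (`exists_projectiveEquationAt`). The theorem combines a finite
type argument, a boundary computation and connectedness.

Finite type: differentiate the equation once more and antisymmetrize. Symmetry of the third
derivatives of `φ` cancels the highest order terms, and for `n ≥ 2` the remainder controls `dΥ`
(`isBigO_of_isBigO_antisymm`). Hence `U = (φ - id, A - id, Υ)` satisfies `dU = O(U)`. If `φ` has the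
2-jet of the identity at a point, then `U` vanishes there, and Gronwall along segments gives `φ =
id` nearby (`eventually_eq_self_of_projectiveEquation`).

Boundary: if `φ` fixes the boundary, then `A` fixes tangential vectors and `B` vanishes on pairs of
them. By hypothesis some `Γ⁰_{kν}` with `k`, `ν` tangential is nonzero at `p`, hence also nearby.
The normal component of the equation on `(e_k, e_ν)` yields `A⁰₀ = 1`. Combining the tangential
equations with the normal component of the mixed ones, a trace kills the tangential part of `Υ`, and
then `A = id` along the boundary near `p` (`normal_fixed_of_projectiveEquation`). Differentiating
this tangentially gives `B = 0` at `p` except on `(e₀, e₀)`. The mixed equation gives `Υ₀ = 0`, and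
the last entry of `B` follows (`jet_eq_of_boundary_fixed`).

Globally, the set of points near which `φ` is the identity is open. It is closed because the 2-jet
is continuous, and it contains `p`; connectedness finishes. -/

noncomputable section

namespace ProjBoundary

open Filter Asymptotics

/-! ### Vanishing of functions dominating their derivative -/

section Gronwall

variable {V W X Y : Type*} [NormedAddCommGroup V] [NormedSpace ℝ V]
  [NormedAddCommGroup W] [NormedSpace ℝ W] [NormedAddCommGroup X] [NormedSpace ℝ X]
  [NormedAddCommGroup Y] [NormedSpace ℝ Y]

/-- Gronwall along the segment from `z₀` to `z`, which convexity keeps inside the domain, even when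
`z₀` is a boundary point of it. -/
lemma eventually_eq_zero_of_fderivWithin_isBigO {H : Set V} (hH : Convex ℝ H) {z₀ : V}
    (hz₀ : z₀ ∈ H) {U : V → W} (hU : ∀ᶠ z in 𝓝[H] z₀, DifferentiableWithinAt ℝ U H z)
    (h0 : U z₀ = 0) (hO : (fderivWithin ℝ U H) =O[𝓝[H] z₀] U) :
    ∀ᶠ z in 𝓝[H] z₀, U z = 0 := by
  obtain ⟨C, hC⟩ := hO.bound
  obtain ⟨ε, hε, hball⟩ := Metric.mem_nhdsWithin_iff.1 (hU.and hC)
  filter_upwards [inter_mem_nhdsWithin H (Metric.ball_mem_nhds z₀ hε)] with z hz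
  have hconv : Convex ℝ (Metric.ball z₀ ε ∩ H) := (convex_ball z₀ ε).inter hH
  set γ : ℝ → V := fun t ↦ z₀ + t • (z - z₀) with hγ
  have hmaps : MapsTo γ (Icc 0 1) (Metric.ball z₀ ε ∩ H) := fun t ht ↦
    hconv.add_smul_sub_mem ⟨Metric.mem_ball_self hε, hz₀⟩ ⟨hz.2, hz.1⟩ ht
  have hder : ∀ t ∈ Icc (0 : ℝ) 1, HasDerivWithinAt (U ∘ γ)
      (fderivWithin ℝ U H (γ t) (z - z₀)) (Icc 0 1) t := fun t ht ↦ by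
    have h1 : HasDerivAt γ (z - z₀) t := by
      have := ((hasDerivAt_id t).smul_const (z - z₀)).const_add z₀
      rwa [one_smul] at this
    exact (hball (hmaps ht)).1.hasFDerivWithinAt.comp_hasDerivWithinAt t h1.hasDerivWithinAt
      fun s hs ↦ (hmaps hs).2
  -- The segment has velocity `z - z₀`, whence the Gronwall constant `C * ‖z - z₀‖`.
  have key := eq_zero_of_abs_deriv_le_mul_abs_self_of_eq_zero_right (f := U ∘ γ)
    (f' := fun t ↦ fderivWithin ℝ U H (γ t) (z - z₀)) (K := C * ‖z - z₀‖) (a := 0) (b := 1)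
    (fun t ht ↦ (hder t ht).continuousWithinAt)
    (fun t ht ↦ (hder t (Ico_subset_Icc_self ht)).mono_of_mem_nhdsWithin
      (Icc_mem_nhdsGE_of_mem ht)) (by simp [hγ, h0])
    (fun t ht ↦ by
      refine (ContinuousLinearMap.le_opNorm _ _).trans ?_
      have := (hball (hmaps (Ico_subset_Icc_self ht))).2
      calc _ ≤ (C * ‖U (γ t)‖) * ‖z - z₀‖ := by gcongr
        _ = _ := by simp only [Function.comp]; ring)
    1 (by simp)
  simpa [hγ] using key

lemma _root_.ContDiffWithinAt.isBigO_one {f : V → W} {s : Set V} {x : V} {k : ℕ∞ω}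
    (hf : ContDiffWithinAt ℝ k f s x) : f =O[𝓝[s] x] (fun _ ↦ (1 : ℝ)) :=
  (hf.continuousWithinAt.tendsto).isBigO_one ℝ

/-- A `C¹` function on a convex set is Lipschitz near each point of smoothness. -/
lemma _root_.ContDiffWithinAt.isBigO_sub_comp {K : Set X} (hK : Convex ℝ K) {F : X → Y} {p₀ : X}
    (hF : ContDiffWithinAt ℝ 1 F K p₀) {ι : Type*} {l : Filter ι} {P Q : ι → X}
    (hP : Tendsto P l (𝓝[K] p₀)) (hQ : Tendsto Q l (𝓝[K] p₀)) :
    (fun z ↦ F (P z) - F (Q z)) =O[l] (fun z ↦ P z - Q z) := by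
  obtain ⟨C, t, ht, hL⟩ := hF.exists_lipschitzOnWith hK
  refine IsBigO.of_bound C ?_
  filter_upwards [hP ht, hQ ht] with z h1 h2
  exact hL.norm_sub_le h1 h2

lemma _root_.ContDiffWithinAt.eventually_differentiableWithinAt {f : V → W} {s : Set V} {x : V}
    (hx : x ∈ s) (hf : ContDiffWithinAt ℝ 1 f s x) :
    ∀ᶠ y in 𝓝[s] x, DifferentiableWithinAt ℝ f s y := by
  have h := hf.eventually (by norm_num)
  rw [insert_eq_of_mem hx] at h
  exact h.mono fun y hy ↦ hy.differentiableWithinAt (by norm_num)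

lemma _root_.Asymptotics.IsBigO.clm_comp {ι : Type*} {l : Filter ι} {a : ι → W →L[ℝ] X}
    {b : ι → V →L[ℝ] W} {f g : ι → ℝ} (ha : a =O[l] f) (hb : b =O[l] g) :
    (fun i ↦ (a i).comp (b i)) =O[l] fun i ↦ f i * g i :=
  (isBigO_of_le l fun i ↦ ((a i).opNorm_comp_le (b i)).trans (Real.le_norm_self _)).trans
    (ha.norm_left.mul hb.norm_left)

lemma _root_.Asymptotics.IsBigO.clm_apply {ι : Type*} {l : Filter ι} {a : ι → W →L[ℝ] X}
    {b : ι → W} {f g : ι → ℝ} (ha : a =O[l] f) (hb : b =O[l] g) :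
    (fun i ↦ a i (b i)) =O[l] fun i ↦ f i * g i :=
  (isBigO_of_le l fun i ↦ ((a i).le_opNorm (b i)).trans (Real.le_norm_self _)).trans
    (ha.norm_left.mul hb.norm_left)

/-- If `F` vanishes along `Q`, then its derivative along `P` is controlled by the first order
difference between `P` and `Q`. -/
lemma isBigO_fderivWithin_comp {K : Set X} (hK : Convex ℝ K) (hKu : UniqueDiffOn ℝ K)
    {F : X → Y} {p₀ : X} (hp₀ : p₀ ∈ K) (hF : ContDiffWithinAt ℝ 2 F K p₀)
    {H : Set V} (hH : UniqueDiffOn ℝ H) {z₀ : V} (hz₀ : z₀ ∈ H) {P Q : V → X}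
    (hP : ContDiffWithinAt ℝ 1 P H z₀) (hQ : ContDiffWithinAt ℝ 1 Q H z₀)
    (hP0 : P z₀ = p₀) (hQ0 : Q z₀ = p₀)
    (hPK : ∀ᶠ z in 𝓝[H] z₀, P z ∈ K) (hQK : ∀ᶠ z in 𝓝[H] z₀, Q z ∈ K)
    (hFQ : ∀ᶠ z in 𝓝[H] z₀, F (Q z) = 0) {g : V → ℝ}
    (hg : (fun z ↦ P z - Q z) =O[𝓝[H] z₀] g)
    (hg' : (fun z ↦ fderivWithin ℝ P H z - fderivWithin ℝ Q H z) =O[𝓝[H] z₀] g) :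
    (fun z ↦ fderivWithin ℝ (fun z ↦ F (P z)) H z) =O[𝓝[H] z₀] g := by
  have tP : Tendsto P (𝓝[H] z₀) (𝓝[K] p₀) :=
    tendsto_nhdsWithin_iff.2 ⟨hP0 ▸ hP.continuousWithinAt.tendsto, hPK⟩
  have tQ : Tendsto Q (𝓝[H] z₀) (𝓝[K] p₀) :=
    tendsto_nhdsWithin_iff.2 ⟨hQ0 ▸ hQ.continuousWithinAt.tendsto, hQK⟩
  have hF' : ContDiffWithinAt ℝ 1 (fderivWithin ℝ F K) K p₀ :=
    hF.fderivWithin_right hKu (by norm_num) hp₀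
  have hP' : ContDiffWithinAt ℝ 0 (fderivWithin ℝ P H) H z₀ :=
    hP.fderivWithin_right hH (by norm_num) hz₀
  have h2 := hF'.isBigO_sub_comp hK tP tQ
  have chain : ∀ {R : V → X}, ContDiffWithinAt ℝ 1 R H z₀ → R z₀ = p₀ →
      Tendsto R (𝓝[H] z₀) (𝓝[K] p₀) → ∀ᶠ z in 𝓝[H] z₀,
      fderivWithin ℝ (fun z ↦ F (R z)) H z =
        (fderivWithin ℝ F K (R z)).comp (fderivWithin ℝ R H z) := by
    intro R hR hR0 tR
    have e1 := (hF.of_le (by norm_num) :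
      ContDiffWithinAt ℝ 1 F K p₀).eventually_differentiableWithinAt hp₀
    have e2 := hR.eventually_differentiableWithinAt hz₀
    have e3 : ∀ᶠ x in 𝓝[H] z₀, R x ∈ K := tR self_mem_nhdsWithin
    filter_upwards [tR e1, e2, eventually_eventually_nhdsWithin.2 e3, self_mem_nhdsWithin]
      with z a1 a2 a3 a4
    exact (a1.hasFDerivWithinAt.comp_of_tendsto z a2.hasFDerivWithinAt
      (tendsto_nhdsWithin_iff.2 ⟨a2.continuousWithinAt.tendsto, a3⟩)).fderivWithin (hH z a4)
  -- Since `D(F ∘ Q) = 0`, one has `D(F ∘ P) = (DF(P) - DF(Q)) DP + DF(Q) (DP - DQ)`. Each term is a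
  -- bounded factor times one of size `O(g)`.
  have b1 : (fun z ↦ (fderivWithin ℝ F K (P z) - fderivWithin ℝ F K (Q z)).comp
      (fderivWithin ℝ P H z)) =O[𝓝[H] z₀] g := by
    simpa only [mul_one] using (h2.trans hg).clm_comp hP'.isBigO_one
  have b2 : (fun z ↦ (fderivWithin ℝ F K (Q z)).comp
      (fderivWithin ℝ P H z - fderivWithin ℝ Q H z)) =O[𝓝[H] z₀] g := by
    have : (fun z ↦ fderivWithin ℝ F K (Q z)) =O[𝓝[H] z₀] (fun _ ↦ (1 : ℝ)) :=
      (hF'.continuousWithinAt.tendsto.comp tQ).isBigO_one ℝ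
    simpa only [one_mul] using this.clm_comp hg'
  refine (b1.add b2).congr' ?_ .rfl
  have hz : ∀ᶠ z in 𝓝[H] z₀, fderivWithin ℝ (fun z ↦ F (Q z)) H z = 0 := by
    filter_upwards [eventually_eventually_nhdsWithin.2 hFQ, self_mem_nhdsWithin] with z h1 h2
    rw [Filter.EventuallyEq.fderivWithin_eq (f := fun _ ↦ (0 : Y)) h1 (h1.self_of_nhdsWithin h2)]
    simp
  filter_upwards [chain hP hP0 tP, chain hQ hQ0 tQ, hz] with z c1 c2 c3
  rw [c1]
  rw [c3] at c2
  ext v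
  have := congrArg (fun L : V →L[ℝ] Y ↦ L v) c2
  simp at this ⊢
  rw [← this]

end Gronwall

/-! ### Projective transformations in coordinates -/

section Coordinates

variable {n : ℕ}

/-- The coordinate expression, at the point `z` of the domain `H`, of the condition that `φ` pulls
back the connection with Christoffel symbols `Γ` to the one projectively related to it by `Υ`. -/
def ProjectiveEquationAt (H : Set (E n)) (Γ : E n → E n →L[ℝ] E n →L[ℝ] E n) (φ : E n → E n)
    (Υ : E n →L[ℝ] ℝ) (z : E n) : Prop :=
  ∀ v w, fderivWithin ℝ (fderivWithin ℝ φ H) H z v w +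
      Γ (φ z) (fderivWithin ℝ φ H z v) (fderivWithin ℝ φ H z w) =
    fderivWithin ℝ φ H z (Γ z v w) + Υ v • fderivWithin ℝ φ H z w + Υ w • fderivWithin ℝ φ H z v

/-- The difference between the image of a connection by a linear map `A` and its pullback. -/
def connectionDefect (Γ : E n → E n →L[ℝ] E n →L[ℝ] E n) (p : E n × E n × (E n →L[ℝ] E n)) :
    E n →L[ℝ] E n →L[ℝ] E n :=
  (ContinuousLinearMap.compL ℝ (E n) (E n) (E n) p.2.2).comp (Γ p.1) -
    ((ContinuousLinearMap.compL ℝ (E n) (E n) (E n)).flip p.2.2).comp ((Γ p.2.1).comp p.2.2)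

lemma connectionDefect_apply (Γ : E n → E n →L[ℝ] E n →L[ℝ] E n) (x y : E n)
    (A : E n →L[ℝ] E n) (v w : E n) :
    connectionDefect Γ (x, y, A) v w = A (Γ x v w) - Γ y (A v) (A w) := rfl

lemma contDiffWithinAt_connectionDefect {Γ : E n → E n →L[ℝ] E n →L[ℝ] E n} {H : Set (E n)}
    {x y : E n} {k : ℕ∞ω} (hx : ContDiffWithinAt ℝ k Γ H x) (hy : ContDiffWithinAt ℝ k Γ H y)
    (A : E n →L[ℝ] E n) :
    ContDiffWithinAt ℝ k (connectionDefect Γ) (H ×ˢ H ×ˢ univ) (x, y, A) := by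
  have h1 : ContDiffWithinAt ℝ k (fun p : E n × E n × (E n →L[ℝ] E n) ↦ Γ p.1)
      (H ×ˢ H ×ˢ univ) (x, y, A) :=
    hx.comp (x, y, A) contDiffWithinAt_fst fun p hp ↦ hp.1
  have h2 : ContDiffWithinAt ℝ k (fun p : E n × E n × (E n →L[ℝ] E n) ↦ Γ p.2.1)
      (H ×ˢ H ×ˢ univ) (x, y, A) :=
    hy.comp (x, y, A) contDiffWithinAt_snd.fst fun p hp ↦ hp.2.1
  have h3 : ContDiffWithinAt ℝ k (fun p : E n × E n × (E n →L[ℝ] E n) ↦ p.2.2)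
      (H ×ˢ H ×ˢ univ) (x, y, A) := contDiffWithinAt_snd.snd
  have h4 : ContDiffWithinAt ℝ k (fun p : E n × E n × (E n →L[ℝ] E n) ↦
      ContinuousLinearMap.compL ℝ (E n) (E n) (E n) p.2.2) (H ×ˢ H ×ˢ univ) (x, y, A) :=
    (show ContDiff ℝ k fun A ↦ ContinuousLinearMap.compL ℝ (E n) (E n) (E n) A by
      fun_prop).comp_contDiffWithinAt h3
  have h5 : ContDiffWithinAt ℝ k (fun p : E n × E n × (E n →L[ℝ] E n) ↦
      (ContinuousLinearMap.compL ℝ (E n) (E n) (E n)).flip p.2.2) (H ×ˢ H ×ˢ univ) (x, y, A) :=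
    (show ContDiff ℝ k fun A ↦ (ContinuousLinearMap.compL ℝ (E n) (E n) (E n)).flip A by
      fun_prop).comp_contDiffWithinAt h3
  exact (h4.clm_comp h1).sub (h5.clm_comp (h2.clm_comp h3))

lemma clm_eq_sum {F : Type*} [NormedAddCommGroup F] [NormedSpace ℝ F] (L : E n →L[ℝ] F) :
    L = ∑ k, (EuclideanSpace.proj k : E n →L[ℝ] ℝ).smulRight (L (EuclideanSpace.single k 1)) := by
  refine ContinuousLinearMap.ext fun v ↦ ?_
  conv_lhs => rw [← (EuclideanSpace.basisFun (Fin n) ℝ).sum_repr v, map_sum]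
  simp

/-- A linear map on `E n` is a finite sum of rank one maps built from its values on the basis, so no
uniformity in the vector is needed. -/
lemma isBigO_of_basis {F ι : Type*} [NormedAddCommGroup F] [NormedSpace ℝ F] {l : Filter ι}
    {L : ι → E n →L[ℝ] F} {g : ι → ℝ}
    (h : ∀ k, (fun i ↦ L i (EuclideanSpace.single k 1)) =O[l] g) : L =O[l] g := by
  have : L = fun i ↦ ∑ k, (EuclideanSpace.proj k : E n →L[ℝ] ℝ).smulRight
      (L i (EuclideanSpace.single k 1)) := funext fun i ↦ clm_eq_sum (L i)
  rw [this]
  refine IsBigO.fun_sum fun k _ ↦ ?_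
  refine (IsBigO.of_bound ‖(EuclideanSpace.proj k : E n →L[ℝ] ℝ)‖ (.of_forall fun i ↦ ?_)).trans
    (h k)
  rw [ContinuousLinearMap.norm_smulRight_apply]

/-- A one-form can be recovered from the projective equation, hence is as smooth as the other
ingredients. -/
lemma contDiffWithinAt_of_projectiveEquation {H : Set (E n)} {z₀ : E n} (hz₀ : z₀ ∈ H)
    {A : E n → E n →L[ℝ] E n} {S : E n → E n →L[ℝ] E n →L[ℝ] E n} {Υ : E n → E n →L[ℝ] ℝ}
    {k : ℕ∞ω} (hA : ContDiffWithinAt ℝ k A H z₀) (hS : ContDiffWithinAt ℝ k S H z₀)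
    (hA0 : A z₀ = ContinuousLinearMap.id ℝ (E n))
    (h : ∀ᶠ z in 𝓝[H] z₀, ∀ v w, S z v w = Υ z v • A z w + Υ z w • A z v) :
    ContDiffWithinAt ℝ k Υ H z₀ := by
  have hb : ∀ j : Fin n, ContDiffWithinAt ℝ k (fun z ↦ Υ z (EuclideanSpace.single j 1)) H z₀ := by
    intro j
    have c1 : ContDiffWithinAt ℝ k (fun z ↦ A z (EuclideanSpace.single j 1) j) H z₀ :=
      (EuclideanSpace.proj j : E n →L[ℝ] ℝ).contDiff.comp_contDiffWithinAt
        (hA.clm_apply contDiffWithinAt_const)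
    have c2 : ContDiffWithinAt ℝ k
        (fun z ↦ S z (EuclideanSpace.single j 1) (EuclideanSpace.single j 1) j) H z₀ :=
      (EuclideanSpace.proj j : E n →L[ℝ] ℝ).contDiff.comp_contDiffWithinAt
        ((hS.clm_apply contDiffWithinAt_const).clm_apply contDiffWithinAt_const)
    -- The `j`-th component on `(e_j, e_j)` reads `2 Υ_j A^j_j`, and `A^j_j = 1` at `z₀`, so `Υ_j`
    -- is obtained by division.
    have hne : 2 * A z₀ (EuclideanSpace.single j 1) j ≠ 0 := by simp [hA0]
    have c3 := c2.div (contDiffWithinAt_const (c := (2 : ℝ)) |>.mul c1) hne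
    have e : (fun z ↦ Υ z (EuclideanSpace.single j 1)) =ᶠ[𝓝[H] z₀] fun z ↦
        S z (EuclideanSpace.single j 1) (EuclideanSpace.single j 1) j /
          (2 * A z (EuclideanSpace.single j 1) j) := by
      have := (contDiffWithinAt_const (c := (2 : ℝ)) |>.mul c1).continuousWithinAt.eventually_ne hne
      filter_upwards [h, this] with z h1 h2
      rw [eq_div_iff h2, h1]
      simp
      ring
    exact c3.congr_of_eventuallyEq e (e.self_of_nhdsWithin hz₀)
  have : Υ = fun z ↦ ∑ j, (EuclideanSpace.proj j : E n →L[ℝ] ℝ).smulRight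
      (Υ z (EuclideanSpace.single j 1)) := funext fun z ↦ clm_eq_sum (Υ z)
  rw [this]
  exact ContDiffWithinAt.sum fun j _ ↦ contDiffWithinAt_const.smulRight (hb j)

/-- The algebraic part of the prolongation of the projective equation. -/
lemma isBigO_of_isBigO_antisymm (hn : 2 ≤ n) {ι : Type*} {l : Filter ι}
    {D : ι → E n →L[ℝ] E n →L[ℝ] ℝ} {g : ι → ℝ}
    (h : ∀ u v w, (fun i ↦ D i u v • w + D i u w • v - D i v u • w - D i v w • u) =O[l] g) :
    D =O[l] g := by
  have hcomp : ∀ (u v w : E n) (j : Fin n),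
      (fun i ↦ D i u v * w j + D i u w * v j - D i v u * w j - D i v w * u j) =O[l] g := by
    intro u v w j
    exact (((EuclideanSpace.proj j : E n →L[ℝ] ℝ).isBigO_comp _ l).trans (h u v w)).congr_left
      fun i ↦ by simp
  have hoff : ∀ k j : Fin n, k ≠ j →
      (fun i ↦ D i (EuclideanSpace.single k 1) (EuclideanSpace.single j 1)) =O[l] g := by
    intro k j hkj
    have h1 := hcomp (.single k 1) (.single j 1) (.single j 1) j
    have h2 := hcomp (.single j 1) (.single k 1) (.single k 1) k
    -- `h1` bounds `2 D_kj - D_jk` and `h2` bounds `2 D_jk - D_kj`; twice the first plus the second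
    -- is `3 D_kj`.
    refine (((h1.const_mul_left 2).add h2).const_mul_left (1 / 3)).congr_left fun i ↦ ?_
    simp [hkj, hkj.symm]
    ring
  refine isBigO_of_basis fun k ↦ isBigO_of_basis fun j ↦ ?_
  by_cases hkj : k = j
  · subst hkj
    -- A second index `j ≠ k` isolates `D_kk`: on `(e_k, e_j, e_k)`, the `j`-th component is `D_kk`
    -- alone.
    have : Nontrivial (Fin n) := Fin.nontrivial_iff_two_le.2 hn
    obtain ⟨j, hj⟩ := exists_ne k
    refine (hcomp (.single k 1) (.single j 1) (.single k 1) j).congr_left fun i ↦ ?_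
    simp [hj]
  · exact hoff k j hkj

end Coordinates

/-! ### Prolongation of the projective equation and uniqueness from the 2-jet. -/

section LocalUniqueness

lemma hasFDerivWithinAt_eval {V W X : Type*} [NormedAddCommGroup V] [NormedSpace ℝ V]
    [NormedAddCommGroup W] [NormedSpace ℝ W] [NormedAddCommGroup X] [NormedSpace ℝ X]
    {L : V → W →L[ℝ] X} {H : Set V} {z : V} {L' : V →L[ℝ] W →L[ℝ] X}
    (h : HasFDerivWithinAt L L' H z) (v : W) :
    HasFDerivWithinAt (fun z ↦ L z v) (L'.flip v) H z := by
  simpa using! h.clm_apply (hasFDerivWithinAt_const v z H)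

lemma fderivWithin_quadratic_equation {V : Type*} [NormedAddCommGroup V] [NormedSpace ℝ V]
    {H : Set V} {z : V} (hz : z ∈ H) (hH : UniqueDiffWithinAt ℝ H z)
    {B f : V → V →L[ℝ] V →L[ℝ] V} {B' f' : V →L[ℝ] V →L[ℝ] V →L[ℝ] V}
    {A : V → V →L[ℝ] V} {A' : V →L[ℝ] V →L[ℝ] V} {Υ : V → V →L[ℝ] ℝ} {Υ' : V →L[ℝ] V →L[ℝ] ℝ}
    (hB : HasFDerivWithinAt B B' H z) (hf : HasFDerivWithinAt f f' H z)
    (hA : HasFDerivWithinAt A A' H z) (hΥ : HasFDerivWithinAt Υ Υ' H z) (v w : V)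
    (h : ∀ᶠ z in 𝓝[H] z, B z v w = f z v w + Υ z v • A z w + Υ z w • A z v) (u : V) :
    B' u v w = f' u v w + (Υ z v • A' u w + Υ' u v • A z w) +
      (Υ z w • A' u v + Υ' u w • A z v) := by
  have lhs := hasFDerivWithinAt_eval (hasFDerivWithinAt_eval hB v) w
  have r1 := hasFDerivWithinAt_eval (hasFDerivWithinAt_eval hf v) w
  have r2 := (hasFDerivWithinAt_eval hΥ v).smul (hasFDerivWithinAt_eval hA w)
  have r3 := (hasFDerivWithinAt_eval hΥ w).smul (hasFDerivWithinAt_eval hA v)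
  have rhs := ((r1.add r2).add r3).congr_of_eventuallyEq h (h.self_of_nhdsWithin hz)
  have := congrArg (fun L : V →L[ℝ] V ↦ L u) (hH.eq lhs rhs)
  simpa using this

variable {n : ℕ}

set_option maxHeartbeats 1000000 in
set_option maxSynthPendingDepth 3 in
/-- A solution of the projective equation with trivial second order jet at a point is trivial. -/
theorem eventually_eq_self_of_projectiveEquation (hn : 2 ≤ n) {H : Set (E n)}
    (hH : Convex ℝ H) (hHi : (interior H).Nonempty) {z₀ : E n} (hz₀ : z₀ ∈ H)
    {Γ : E n → E n →L[ℝ] E n →L[ℝ] E n} (hΓ : ContDiffWithinAt ℝ 2 Γ H z₀)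
    {φ : E n → E n} (hφ : ContDiffWithinAt ℝ 4 φ H z₀) (hφH : ∀ᶠ z in 𝓝[H] z₀, φ z ∈ H)
    (h0 : φ z₀ = z₀) (h1 : fderivWithin ℝ φ H z₀ = ContinuousLinearMap.id ℝ (E n))
    (h2 : fderivWithin ℝ (fderivWithin ℝ φ H) H z₀ = 0) {Υ : E n → E n →L[ℝ] ℝ}
    (hΥ : ∀ᶠ z in 𝓝[H] z₀, ProjectiveEquationAt H Γ φ (Υ z) z) :
    ∀ᶠ z in 𝓝[H] z₀, φ z = z := by
  have hHu : UniqueDiffOn ℝ H := uniqueDiffOn_convex hH hHi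
  set A := fderivWithin ℝ φ H with hAdef
  set B := fderivWithin ℝ A H with hBdef
  have cA : ContDiffWithinAt ℝ 3 A H z₀ := hφ.fderivWithin_right hHu (by norm_num) hz₀
  have cB : ContDiffWithinAt ℝ 2 B H z₀ := cA.fderivWithin_right hHu (by norm_num) hz₀
  set P : E n → E n × E n × (E n →L[ℝ] E n) := fun z ↦ (z, φ z, A z) with hP
  -- `Q` is the 1-jet of the identity, on which `connectionDefect Γ` vanishes; terms in `P` are
  -- estimated by comparison with `Q`.
  set Q : E n → E n × E n × (E n →L[ℝ] E n) := fun z ↦ (z, z, ContinuousLinearMap.id ℝ (E n))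
    with hQ
  set K : Set (E n × E n × (E n →L[ℝ] E n)) := H ×ˢ H ×ˢ univ with hK
  have hKc : Convex ℝ K := hH.prod (hH.prod convex_univ)
  have hKu : UniqueDiffOn ℝ K := hHu.prod (hHu.prod uniqueDiffOn_univ)
  have cP : ContDiffWithinAt ℝ 2 P H z₀ :=
    contDiffWithinAt_id.prodMk ((hφ.of_le (by norm_num)).prodMk (cA.of_le (by norm_num)))
  have cQ : ContDiffWithinAt ℝ 2 Q H z₀ :=
    contDiffWithinAt_id.prodMk (contDiffWithinAt_id.prodMk contDiffWithinAt_const)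
  have hP0 : P z₀ = (z₀, z₀, ContinuousLinearMap.id ℝ (E n)) := by simp only [hP, h0, h1]
  have hPK : ∀ᶠ z in 𝓝[H] z₀, P z ∈ K := by
    filter_upwards [hφH, self_mem_nhdsWithin] with z a b using ⟨b, a, mem_univ _⟩
  have hQK : ∀ᶠ z in 𝓝[H] z₀, Q z ∈ K := by
    filter_upwards [self_mem_nhdsWithin] with z b using ⟨b, b, mem_univ _⟩
  have hcont : ContDiffWithinAt ℝ 2 (connectionDefect Γ) K
      (z₀, z₀, ContinuousLinearMap.id ℝ (E n)) := contDiffWithinAt_connectionDefect hΓ hΓ _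
  set f : E n → E n →L[ℝ] E n →L[ℝ] E n := fun z ↦ connectionDefect Γ (P z) with hf
  have cf : ContDiffWithinAt ℝ 2 f H z₀ :=
    ContDiffWithinAt.comp_of_preimage_mem_nhdsWithin (g := connectionDefect Γ) z₀
      (by rw [hP0]; exact hcont) cP hPK
  have hFQ : ∀ z, connectionDefect Γ (Q z) = 0 := fun z ↦ by
    ext v w : 2
    simp [hQ, connectionDefect_apply]
  have heq : ∀ᶠ z in 𝓝[H] z₀, ∀ v w, B z v w = f z v w + Υ z v • A z w + Υ z w • A z v := by
    filter_upwards [hΥ] with z hz v w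
    have := hz v w
    simp only [hf, hP, connectionDefect_apply]
    rw [← eq_sub_iff_add_eq] at this
    rw [this]
    abel
  -- No regularity of `Υ` is assumed; it is recovered from `B - f`.
  have cΥ : ContDiffWithinAt ℝ 2 Υ H z₀ := by
    refine contDiffWithinAt_of_projectiveEquation hz₀ (A := A) (S := fun z ↦ B z - f z)
      (cA.of_le (by norm_num)) (cB.sub cf) h1 ?_
    filter_upwards [heq] with z hz v w
    simp [hz v w, add_assoc]
  have hΥ0 : Υ z₀ = 0 := by
    ext v
    have hv := heq.self_of_nhdsWithin hz₀ v v
    have hf0 : f z₀ = 0 := by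
      simp only [hf, hP0]
      exact hFQ z₀
    rw [h2, hf0, h1] at hv
    have hv' : (2 * Υ z₀ v) • v = 0 := by
      rw [mul_smul, two_smul]
      simpa using hv.symm
    rcases smul_eq_zero.1 hv' with h | h
    · simpa using h
    · simp [h]
  -- The unknowns of the closed first order system. `B` is not among them, being algebraic in the
  -- others by `heq`.
  set U : E n → E n × (E n →L[ℝ] E n) × (E n →L[ℝ] ℝ) :=
    fun z ↦ (φ z - z, A z - ContinuousLinearMap.id ℝ (E n), Υ z) with hU
  set g : E n → ℝ := fun z ↦ ‖U z‖ with hg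
  set l := 𝓝[H] z₀ with hl
  have Oφ : (fun z ↦ φ z - z) =O[l] g := isBigO_of_le _ fun z ↦ by
    simpa [hg] using norm_fst_le (U z)
  have OA : (fun z ↦ A z - ContinuousLinearMap.id ℝ (E n)) =O[l] g := isBigO_of_le _ fun z ↦ by
    simpa [hg] using (norm_fst_le (U z).2).trans (norm_snd_le (U z))
  have OΥ : Υ =O[l] g := isBigO_of_le _ fun z ↦ by
    simpa [hg] using (norm_snd_le (U z).2).trans (norm_snd_le (U z))
  have OPQ : (fun z ↦ P z - Q z) =O[l] g := by
    refine ((isBigO_zero g l).prod_left (Oφ.prod_left OA)).congr_left fun z ↦ ?_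
    simp [hP, hQ]
  have tP : Tendsto P l (𝓝[K] (z₀, z₀, ContinuousLinearMap.id ℝ (E n))) :=
    tendsto_nhdsWithin_iff.2 ⟨hP0 ▸ cP.continuousWithinAt.tendsto, hPK⟩
  have tQ : Tendsto Q l (𝓝[K] (z₀, z₀, ContinuousLinearMap.id ℝ (E n))) :=
    tendsto_nhdsWithin_iff.2 ⟨cQ.continuousWithinAt.tendsto, hQK⟩
  have Of : f =O[l] g := by
    refine (((hcont.of_le (by norm_num) : ContDiffWithinAt ℝ 1 _ K _).isBigO_sub_comp hKc tP
      tQ).trans OPQ).congr_left fun z ↦ ?_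
    simp [hFQ, hf]
  have eval : ∀ {F : Type} [NormedAddCommGroup F] [NormedSpace ℝ F] {L : E n → E n →L[ℝ] F}
      {k : E n → ℝ} (v : E n), L =O[l] k → (fun z ↦ L z v) =O[l] k := fun v h ↦ by
    simpa only [mul_one] using h.clm_apply (isBigO_refl (fun _ ↦ v) l |>.trans
      (isBigO_const_const v (one_ne_zero (α := ℝ)) l))
  have oneA : A =O[l] fun _ ↦ (1 : ℝ) := cA.isBigO_one
  have OB : B =O[l] g := by
    refine isBigO_of_basis fun i ↦ isBigO_of_basis fun j ↦ ?_
    have a1 := eval (.single j 1) (eval (.single i 1) Of)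
    have a2 := (eval (.single i 1) OΥ).smul (eval (.single j 1) oneA)
    have a3 := (eval (.single j 1) OΥ).smul (eval (.single i 1) oneA)
    simp only [smul_eq_mul, mul_one] at a2 a3
    refine ((a1.add a2).add a3).congr' ?_ .rfl
    filter_upwards [heq] with z hz using (hz _ _).symm
  have dA : ∀ᶠ z in l, DifferentiableWithinAt ℝ A H z :=
    (cA.of_le (by norm_num)).eventually_differentiableWithinAt hz₀
  have dB : ∀ᶠ z in l, DifferentiableWithinAt ℝ B H z :=
    (cB.of_le (by norm_num)).eventually_differentiableWithinAt hz₀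
  have dφ : ∀ᶠ z in l, DifferentiableWithinAt ℝ φ H z :=
    (hφ.of_le (by norm_num)).eventually_differentiableWithinAt hz₀
  have df : ∀ᶠ z in l, DifferentiableWithinAt ℝ f H z :=
    (cf.of_le (by norm_num)).eventually_differentiableWithinAt hz₀
  have dΥ : ∀ᶠ z in l, DifferentiableWithinAt ℝ Υ H z :=
    (cΥ.of_le (by norm_num)).eventually_differentiableWithinAt hz₀
  have mem : ∀ᶠ z in l, z ∈ H := self_mem_nhdsWithin
  -- `f` is the defect along `P`. The derivative of `P - Q` has components `0`, `A - id` and `B`, so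
  -- the bound on `B` is already needed here.
  have Odf : fderivWithin ℝ f H =O[l] g := by
    refine isBigO_fderivWithin_comp hKc hKu ⟨hz₀, hz₀, mem_univ _⟩ hcont hHu hz₀
      (cP.of_le (by norm_num)) (cQ.of_le (by norm_num)) hP0 rfl hPK hQK (.of_forall hFQ) OPQ ?_
    have e : ∀ᶠ z in l, fderivWithin ℝ P H z - fderivWithin ℝ Q H z =
        (0 : E n →L[ℝ] E n).prod ((A z - ContinuousLinearMap.id ℝ (E n)).prod (B z)) := by
      filter_upwards [dA, dφ, mem] with z a1 a2 a3
      have b1 : HasFDerivWithinAt P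
          ((ContinuousLinearMap.id ℝ (E n)).prod ((A z).prod (B z))) H z :=
        (hasFDerivWithinAt_id z H).prodMk (a2.hasFDerivWithinAt.prodMk a1.hasFDerivWithinAt)
      have b2 : HasFDerivWithinAt Q
          ((ContinuousLinearMap.id ℝ (E n)).prod ((ContinuousLinearMap.id ℝ (E n)).prod 0)) H z :=
        (hasFDerivWithinAt_id z H).prodMk
          ((hasFDerivWithinAt_id z H).prodMk (hasFDerivWithinAt_const _ z H))
      rw [b1.fderivWithin (hHu z a3), b2.fderivWithin (hHu z a3)]
      ext v : 1
      simp
    refine IsBigO.congr' (f₁ := fun z ↦ (0 : E n →L[ℝ] E n).prod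
      ((A z - ContinuousLinearMap.id ℝ (E n)).prod (B z))) ?_ (e.mono fun z h ↦ h.symm) .rfl
    exact isBigO_of_basis fun k ↦ (isBigO_zero g l).prod_left ((eval _ OA).prod_left (eval _ OB))
  have onedΥ : fderivWithin ℝ Υ H =O[l] fun _ ↦ (1 : ℝ) :=
    (cΥ.fderivWithin_right (m := 1) hHu (by norm_num) hz₀).isBigO_one
  have symm : ∀ᶠ z in l, ∀ u v, fderivWithin ℝ B H z u v = fderivWithin ℝ B H z v u := by
    have h := (cA.eventually (by norm_num))
    rw [insert_eq_of_mem hz₀] at h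
    filter_upwards [h, mem] with z a1 a2
    refine ContDiffWithinAt.isSymmSndFDerivWithinAt a1
      (by rw [minSmoothness_of_isRCLikeNormedField]; norm_num) hHu ?_ a2
    rw [hH.closure_interior_eq_closure_of_nonempty_interior hHi]
    exact subset_closure a2
  have key : ∀ v w, ∀ᶠ z in l, ∀ u, fderivWithin ℝ B H z u v w = fderivWithin ℝ f H z u v w +
      (Υ z v • B z u w + fderivWithin ℝ Υ H z u v • A z w) +
      (Υ z w • B z u v + fderivWithin ℝ Υ H z u w • A z v) := by
    intro v w
    have heq' : ∀ᶠ z in l, B z v w = f z v w + Υ z v • A z w + Υ z w • A z v :=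
      heq.mono fun z hz ↦ hz v w
    filter_upwards [eventually_eventually_nhdsWithin.2 heq', dA, dB, df, dΥ, mem]
      with z c1 c2 c3 c4 c5 c6 u
    exact fderivWithin_quadratic_equation c6 (hHu z c6) c3.hasFDerivWithinAt
      c4.hasFDerivWithinAt c2.hasFDerivWithinAt c5.hasFDerivWithinAt v w c1 u
  -- Compare `key v w` at `u` with `key u w` at `v`: the left sides agree by symmetry of the third
  -- derivatives. Replacing `A z` by the identity in the `dΥ` terms costs `O(g)`, as `dΥ` is
  -- bounded.
  have OdΥ : fderivWithin ℝ Υ H =O[l] g := by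
    refine isBigO_of_isBigO_antisymm hn fun u v w ↦ ?_
    have t1 : ∀ a b c, (fun z ↦ Υ z a • B z b c) =O[l] g := fun a b c ↦ by
      simpa using (eval a (cΥ.isBigO_one)).smul (eval c (eval b OB))
    have t2 : ∀ a b c, (fun z ↦ fderivWithin ℝ Υ H z a b • (A z c - c)) =O[l] g :=
      fun a b c ↦ by
        simpa using (eval b (eval a onedΥ)).smul (eval c OA)
    have t3 : ∀ a b c, (fun z ↦ fderivWithin ℝ f H z a b c) =O[l] g := fun a b c ↦
      eval c (eval b (eval a Odf))
    refine ((((((((((t3 v u w).sub (t3 u v w)).add (t1 u v w)).add (t1 w v u)).sub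
      (t1 v u w)).sub (t1 w u v)).sub (t2 u v w)).sub (t2 u w v)).add (t2 v u w)).add
      (t2 v w u)).congr' ?_ .rfl
    filter_upwards [key v w, key u w, symm] with z k1 k2 k3
    have k1 := k1 u
    have k2 := k2 v
    rw [k3 u v, k2] at k1
    rw [← sub_eq_zero] at k1
    rw [← sub_eq_zero, ← k1]
    simp only [smul_sub]
    abel
  have dU : ∀ᶠ z in l, HasFDerivWithinAt U ((A z - ContinuousLinearMap.id ℝ (E n)).prod
      ((B z).prod (fderivWithin ℝ Υ H z))) H z := by
    filter_upwards [dA, dφ, dΥ] with z c1 c2 c3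
    exact (c2.hasFDerivWithinAt.sub (hasFDerivWithinAt_id z H)).prodMk
      ((c1.hasFDerivWithinAt.sub_const _).prodMk c3.hasFDerivWithinAt)
  have OdU : fderivWithin ℝ U H =O[l] U := by
    refine IsBigO.trans ?_ (isBigO_refl U l).norm_left
    refine IsBigO.congr' (f₁ := fun z ↦ (A z - ContinuousLinearMap.id ℝ (E n)).prod
      ((B z).prod (fderivWithin ℝ Υ H z))) (g₁ := g) ?_ ?_ .rfl
    · exact isBigO_of_basis fun k ↦ (eval _ OA).prod_left ((eval _ OB).prod_left (eval _ OdΥ))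
    · filter_upwards [dU, mem] with z a1 a2 using (a1.fderivWithin (hHu z a2)).symm
  have hU0 : U z₀ = 0 := by
    simp [hU, h0, h1, hΥ0]
  filter_upwards [eventually_eq_zero_of_fderivWithin_isBigO hH hz₀
    (dU.mono fun z h ↦ h.differentiableWithinAt) hU0 OdU] with z hz
  exact sub_eq_zero.1 (congrArg Prod.fst hz)

end LocalUniqueness

/-! ### The 2-jet at the boundary of a projective transformation fixing it. -/

section Boundary

variable {n : ℕ}

lemma clm_eq_of_basis {F : Type*} [NormedAddCommGroup F] [NormedSpace ℝ F] {L L' : E n →L[ℝ] F}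
    (h : ∀ k, L (EuclideanSpace.single k 1) = L' (EuclideanSpace.single k 1)) : L = L' := by
  rw [clm_eq_sum L, clm_eq_sum L']
  simp [h]

variable [NeZero n]

lemma convex_halfSpace : Convex ℝ {z : E n | 0 ≤ z 0} :=
  convex_halfSpace_ge (EuclideanSpace.proj 0 : E n →L[ℝ] ℝ).toLinearMap.isLinear 0

lemma interior_halfSpace_nonempty : (interior {z : E n | 0 ≤ z 0}).Nonempty := by
  refine ⟨EuclideanSpace.single 0 1, mem_interior.2 ⟨{z : E n | 0 < z 0}, fun z (hz : 0 < z 0) ↦ hz.le,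
    isOpen_lt continuous_const (EuclideanSpace.proj 0 : E n →L[ℝ] ℝ).continuous, by simp⟩⟩

lemma uniqueDiffOn_halfSpace : UniqueDiffOn ℝ {z : E n | 0 ≤ z 0} :=
  uniqueDiffOn_convex convex_halfSpace interior_halfSpace_nonempty

/-- Functions on the half space that agree on the boundary have the same tangential derivatives. -/
lemma fderivWithin_halfSpace_single_eq {F : Type*} [NormedAddCommGroup F] [NormedSpace ℝ F]
    {f g : E n → F} {z : E n} (hz : z 0 = 0)
    (hf : DifferentiableWithinAt ℝ f {z : E n | 0 ≤ z 0} z)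
    (hg : DifferentiableWithinAt ℝ g {z : E n | 0 ≤ z 0} z)
    (h : f =ᶠ[𝓝[{z : E n | z 0 = 0}] z] g) {j : Fin n} (hj : j ≠ 0) :
    fderivWithin ℝ f {z : E n | 0 ≤ z 0} z (EuclideanSpace.single j 1) =
      fderivWithin ℝ g {z : E n | 0 ≤ z 0} z (EuclideanSpace.single j 1) := by
  -- This line stays in the boundary for positive and negative `t`, so both derivatives are
  -- two-sided derivatives along it.
  set γ : ℝ → E n := fun t ↦ z + t • EuclideanSpace.single j 1 with hγ
  have hγ0 : γ 0 = z := by simp [hγ]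
  have hγ' : HasDerivAt γ (EuclideanSpace.single j 1) 0 := by
    have := ((hasDerivAt_id (0 : ℝ)).smul_const
      (EuclideanSpace.single j 1 : E n)).const_add z
    rwa [one_smul] at this
  have hmem : ∀ t, γ t 0 = 0 := fun t ↦ by simp [hγ, hz, hj.symm]
  have ht : Tendsto γ (𝓝 0) (𝓝[{z : E n | z 0 = 0}] z) :=
    tendsto_nhdsWithin_iff.2 ⟨by simpa [hγ0] using hγ'.continuousAt.tendsto, .of_forall hmem⟩
  have comp : ∀ {k : E n → F}, DifferentiableWithinAt ℝ k {z : E n | 0 ≤ z 0} z →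
      HasDerivAt (k ∘ γ)
        (fderivWithin ℝ k {z : E n | 0 ≤ z 0} z (EuclideanSpace.single j 1)) 0 := fun {k} hk ↦ by
    have hk' : HasFDerivWithinAt k (fderivWithin ℝ k {z : E n | 0 ≤ z 0} z)
        {z : E n | 0 ≤ z 0} (γ 0) := by rw [hγ0]; exact hk.hasFDerivWithinAt
    rw [← hasDerivWithinAt_univ] at hγ' ⊢
    exact hk'.comp_hasDerivWithinAt 0 hγ' fun t _ ↦ (hmem t).ge
  exact (comp hf).unique ((comp hg).congr_of_eventuallyEq (ht.eventually h))

/-- A linear map that fixes the tangential vectors of the half space. -/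
lemma clm_apply_of_fix_tangential {A : E n →L[ℝ] E n}
    (hA : ∀ j : Fin n, j ≠ 0 → A (EuclideanSpace.single j 1) = EuclideanSpace.single j 1)
    (u : E n) :
    A u = u + u 0 • (A (EuclideanSpace.single 0 1) - EuclideanSpace.single 0 1) := by
  have : A = ContinuousLinearMap.id ℝ (E n) + (EuclideanSpace.proj 0 : E n →L[ℝ] ℝ).smulRight
      (A (EuclideanSpace.single 0 1) - EuclideanSpace.single 0 1) := by
    refine clm_eq_of_basis fun k ↦ ?_
    by_cases hk : k = 0
    · subst hk
      simp
    · simp [hA k hk, Ne.symm hk]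
  conv_lhs => rw [this]
  simp

/-- The algebra of the projective equation at a boundary point with nonzero second fundamental
form: the normal vector is fixed. -/
lemma normal_fixed_of_projectiveEquation {G : E n →L[ℝ] E n →L[ℝ] E n} {A : E n →L[ℝ] E n}
    {B : E n →L[ℝ] E n →L[ℝ] E n} {Υ : E n →L[ℝ] ℝ}
    (h : ∀ v w, B v w + G (A v) (A w) = A (G v w) + Υ v • A w + Υ w • A v)
    (hA : ∀ j : Fin n, j ≠ 0 → A (EuclideanSpace.single j 1) = EuclideanSpace.single j 1)
    (hB : ∀ i j : Fin n, i ≠ 0 → j ≠ 0 →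
      B (EuclideanSpace.single i 1) (EuclideanSpace.single j 1) = 0)
    (hc0 : A (EuclideanSpace.single 0 1) 0 = 1)
    (hB0 : ∀ i : Fin n, i ≠ 0 →
      B (EuclideanSpace.single i 1) (EuclideanSpace.single 0 1) 0 = 0)
    {k ν : Fin n} (hk : k ≠ 0) (hν : ν ≠ 0)
    (hG : G (EuclideanSpace.single k 1) (EuclideanSpace.single ν 1) 0 ≠ 0) :
    A = ContinuousLinearMap.id ℝ (E n) ∧ ∀ i : Fin n, i ≠ 0 → Υ (EuclideanSpace.single i 1) = 0 := by
  set c := A (EuclideanSpace.single 0 1) - EuclideanSpace.single 0 1 with hc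
  have hcz : c 0 = 0 := by simp [hc, hc0]
  have hAu : ∀ u, A u = u + u 0 • c := clm_apply_of_fix_tangential hA
  -- Here `B` drops out, and `A (G e_i e_j)` differs from `G e_i e_j` by `G⁰_{ij} c`.
  have tang : ∀ i j : Fin n, i ≠ 0 → j ≠ 0 →
      G (EuclideanSpace.single i 1) (EuclideanSpace.single j 1) 0 • c +
        Υ (EuclideanSpace.single i 1) • EuclideanSpace.single j (1 : ℝ) +
        Υ (EuclideanSpace.single j 1) • EuclideanSpace.single i (1 : ℝ) = 0 := by
    intro i j hi hj
    have := h (EuclideanSpace.single i 1) (EuclideanSpace.single j 1)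
    rw [hB i j hi hj, hA i hi, hA j hj, hAu (G _ _), zero_add, add_assoc, add_assoc] at this
    rw [add_assoc]
    exact (left_eq_add.1 this)
  have csum : c = ∑ j ∈ Finset.univ.erase (0 : Fin n), c j • EuclideanSpace.single j (1 : ℝ) := by
    conv_lhs => rw [← (EuclideanSpace.basisFun (Fin n) ℝ).sum_repr c]
    rw [← Finset.add_sum_erase _ _ (Finset.mem_univ (0 : Fin n))]
    simp [hcz]
  have hΥ : ∀ i : Fin n, i ≠ 0 → Υ (EuclideanSpace.single i 1) = 0 := by
    intro i hi
    -- Normal component of the equation on `(e_i, e₀)`: `A` preserves normal components because `c`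
    -- is tangential.
    have mixed : G (EuclideanSpace.single i 1) c 0 = Υ (EuclideanSpace.single i 1) := by
      have := congrArg (fun v : E n ↦ v 0)
        (h (EuclideanSpace.single i 1) (EuclideanSpace.single 0 1))
      have e0 : A (EuclideanSpace.single 0 1) = EuclideanSpace.single 0 1 + c := by simp [hc]
      rw [hA i hi, hAu (G _ _), e0, map_add] at this
      simpa [hB0 i hi, hcz, Ne.symm hi] using this
    -- The same quantity again, as the sum over tangential `j` of the `j`-th components of `tang i
    -- j`; the term `j = i` counts twice.
    have trace : G (EuclideanSpace.single i 1) c 0 = ∑ j ∈ Finset.univ.erase (0 : Fin n),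
        -(Υ (EuclideanSpace.single i 1) +
          if j = i then Υ (EuclideanSpace.single i 1) else 0) := by
      conv_lhs => rw [csum, map_sum]
      rw [WithLp.ofLp_sum, Finset.sum_apply]
      refine Finset.sum_congr rfl fun j hj ↦ ?_
      have := congrArg (fun v : E n ↦ v j) (tang i j hi (Finset.ne_of_mem_erase hj))
      simp only [PiLp.add_apply, PiLp.smul_apply, smul_eq_mul, PiLp.single_apply,
        PiLp.zero_apply, if_true, mul_one] at this
      simp only [map_smul, PiLp.smul_apply, smul_eq_mul]
      by_cases hij : j = i
      · rw [if_pos hij, mul_one, hij] at this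
        rw [if_pos hij, hij]
        linarith
      · rw [if_neg hij, mul_zero] at this
        rw [if_neg hij]
        linarith
    rw [mixed, Finset.sum_neg_distrib, Finset.sum_add_distrib, Finset.sum_const,
      Finset.sum_ite_eq', if_pos (by simp [hi]), nsmul_eq_mul] at trace
    -- The factor is `(n - 1) + 2 = n + 1`, hence positive.
    have h2 : Υ (EuclideanSpace.single i 1) *
        ((Finset.univ.erase (0 : Fin n)).card + 2) = 0 := by linarith
    rcases mul_eq_zero.1 h2 with h3 | h3
    · exact h3
    · have h4 : (0 : ℝ) ≤ (Finset.univ.erase (0 : Fin n)).card := Nat.cast_nonneg _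
      linarith
  refine ⟨?_, hΥ⟩
  have := tang k ν hk hν
  rw [hΥ k hk, hΥ ν hν, zero_smul, zero_smul, add_zero, add_zero] at this
  have c0 : c = 0 := (smul_eq_zero.1 this).resolve_left hG
  ext1 u
  rw [hAu u, c0]
  simp

/-- A solution of the projective equation on the half space which is trivial along the boundary
has trivial second order jet at the points where the second fundamental form of the boundary does
not vanish. -/
theorem jet_eq_of_boundary_fixed {z₀ : E n} (hz₀ : z₀ 0 = 0)
    {Γ : E n → E n →L[ℝ] E n →L[ℝ] E n}
    (hΓ : ContinuousWithinAt Γ {z : E n | 0 ≤ z 0} z₀)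
    {φ : E n → E n} (hφ : ContDiffWithinAt ℝ 3 φ {z : E n | 0 ≤ z 0} z₀)
    (hfix : ∀ᶠ z in 𝓝[{z : E n | z 0 = 0}] z₀, φ z = z) {Υ : E n → E n →L[ℝ] ℝ}
    (hΥ : ∀ᶠ z in 𝓝[{z : E n | 0 ≤ z 0}] z₀,
      ProjectiveEquationAt {z : E n | 0 ≤ z 0} Γ φ (Υ z) z)
    {k ν : Fin n} (hk : k ≠ 0) (hν : ν ≠ 0)
    (hG : Γ z₀ (EuclideanSpace.single k 1) (EuclideanSpace.single ν 1) 0 ≠ 0) :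
    fderivWithin ℝ φ {z : E n | 0 ≤ z 0} z₀ = ContinuousLinearMap.id ℝ (E n) ∧
      fderivWithin ℝ (fderivWithin ℝ φ {z : E n | 0 ≤ z 0}) {z : E n | 0 ≤ z 0} z₀ = 0 := by
  set H := {z : E n | 0 ≤ z 0} with hH
  set D := {z : E n | z 0 = 0} with hD
  have hDH : D ⊆ H := fun z hz ↦ (show z 0 = 0 from hz).ge
  have hHu : UniqueDiffOn ℝ H := uniqueDiffOn_halfSpace
  have hzD : z₀ ∈ D := hz₀
  have hzH : z₀ ∈ H := hDH hzD
  have hle : 𝓝[D] z₀ ≤ 𝓝[H] z₀ := nhdsWithin_mono _ hDH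
  have mem : ∀ᶠ z in 𝓝[D] z₀, z ∈ D := self_mem_nhdsWithin
  set A := fderivWithin ℝ φ H with hAdef
  set B := fderivWithin ℝ A H with hBdef
  have cA : ContDiffWithinAt ℝ 2 A H z₀ := hφ.fderivWithin_right hHu (by norm_num) hzH
  have dφ : ∀ᶠ z in 𝓝[D] z₀, DifferentiableWithinAt ℝ φ H z :=
    hle ((hφ.of_le (by norm_num)).eventually_differentiableWithinAt hzH)
  have dA : ∀ᶠ z in 𝓝[D] z₀, DifferentiableWithinAt ℝ A H z :=
    hle ((cA.of_le (by norm_num)).eventually_differentiableWithinAt hzH)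
  have hA : ∀ᶠ z in 𝓝[D] z₀, ∀ j : Fin n, j ≠ 0 →
      A z (EuclideanSpace.single j 1) = EuclideanSpace.single j 1 := by
    filter_upwards [eventually_eventually_nhdsWithin.2 hfix, dφ, mem] with z h1 h2 h3 j hj
    have := fderivWithin_halfSpace_single_eq h3 h2 differentiableWithinAt_id h1 hj
    rw [hAdef, this, fderivWithin_id (hHu z (hDH h3))]
    rfl
  have hB : ∀ᶠ z in 𝓝[D] z₀, ∀ i j : Fin n, i ≠ 0 → j ≠ 0 →
      B z (EuclideanSpace.single i 1) (EuclideanSpace.single j 1) = 0 := by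
    filter_upwards [eventually_eventually_nhdsWithin.2 hA, dA, mem] with z h1 h2 h3 i j hi hj
    have e := hasFDerivWithinAt_eval h2.hasFDerivWithinAt (EuclideanSpace.single j 1)
    have := fderivWithin_halfSpace_single_eq h3 e.differentiableWithinAt
      (differentiableWithinAt_const (EuclideanSpace.single j (1 : ℝ)))
      (h1.mono fun z hz ↦ hz j hj) hi
    rw [e.fderivWithin (hHu z (hDH h3))] at this
    simpa using! this
  -- Nonvanishing is needed on a boundary neighbourhood, not just at `z₀`, since its consequences
  -- `hc` and `hAid` are differentiated tangentially.
  have hGne : ∀ᶠ z in 𝓝[D] z₀,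
      Γ z (EuclideanSpace.single k 1) (EuclideanSpace.single ν 1) 0 ≠ 0 := by
    have cont : ContinuousWithinAt (fun z ↦
        Γ z (EuclideanSpace.single k 1) (EuclideanSpace.single ν 1) 0) H z₀ :=
      (EuclideanSpace.proj 0 : E n →L[ℝ] ℝ).continuous.continuousAt.comp_continuousWithinAt
        ((hΓ.clm_apply continuousWithinAt_const).clm_apply continuousWithinAt_const)
    exact hle (cont.eventually_ne hG)
  have heq : ∀ᶠ z in 𝓝[D] z₀, ∀ v w, B z v w + Γ z (A z v) (A z w) =
      A z (Γ z v w) + Υ z v • A z w + Υ z w • A z v := by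
    filter_upwards [hle hΥ, hfix] with z h1 h2 v w
    have := h1 v w
    rwa [h2] at this
  -- The normal component on `(e_k, e_ν)` is `Γ⁰_{kν} = A⁰₀ Γ⁰_{kν}`; the `Υ` terms are tangential.
  have hc : ∀ᶠ z in 𝓝[D] z₀, A z (EuclideanSpace.single 0 1) 0 = 1 := by
    filter_upwards [heq, hA, hB, hGne] with z h1 h2 h3 h4
    have := congrArg (fun v : E n ↦ v 0)
      (h1 (EuclideanSpace.single k 1) (EuclideanSpace.single ν 1))
    rw [h3 k ν hk hν, h2 k hk, h2 ν hν, clm_apply_of_fix_tangential h2 (Γ z _ _)] at this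
    simp [hk.symm, hν.symm, h4] at this
    linarith
  have hB0 : ∀ᶠ z in 𝓝[D] z₀, ∀ i : Fin n, i ≠ 0 →
      B z (EuclideanSpace.single i 1) (EuclideanSpace.single 0 1) 0 = 0 := by
    filter_upwards [eventually_eventually_nhdsWithin.2 hc, dA, mem] with z h1 h2 h3 i hi
    have e : HasFDerivWithinAt (fun z ↦ A z (EuclideanSpace.single 0 1) 0)
        ((EuclideanSpace.proj 0 : E n →L[ℝ] ℝ).comp ((B z).flip (EuclideanSpace.single 0 1)))
        H z := (EuclideanSpace.proj 0 : E n →L[ℝ] ℝ).hasFDerivAt.comp_hasFDerivWithinAt z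
      (hasFDerivWithinAt_eval h2.hasFDerivWithinAt (EuclideanSpace.single 0 1))
    have := fderivWithin_halfSpace_single_eq h3 e.differentiableWithinAt
      (differentiableWithinAt_const (1 : ℝ)) h1 hi
    rw [e.fderivWithin (hHu z (hDH h3))] at this
    simpa using! this
  have hAid : ∀ᶠ z in 𝓝[D] z₀, A z = ContinuousLinearMap.id ℝ (E n) := by
    filter_upwards [heq, hA, hB, hc, hB0, hGne] with z h1 h2 h3 h4 h5 h6
    exact (normal_fixed_of_projectiveEquation h1 h2 h3 h4 h5 hk hν h6).1
  have hA0 : A z₀ = ContinuousLinearMap.id ℝ (E n) := hAid.self_of_nhdsWithin hzD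
  have heq0 := heq.self_of_nhdsWithin hzD
  have hΥ0 := (normal_fixed_of_projectiveEquation heq0 (hA.self_of_nhdsWithin hzD)
    (hB.self_of_nhdsWithin hzD) (hc.self_of_nhdsWithin hzD) (hB0.self_of_nhdsWithin hzD) hk hν
    hG).2
  refine ⟨hA0, ?_⟩
  have hBt : ∀ i : Fin n, i ≠ 0 → B z₀ (EuclideanSpace.single i 1) = 0 := by
    intro i hi
    have := fderivWithin_halfSpace_single_eq hz₀ (dA.self_of_nhdsWithin hzD)
      (differentiableWithinAt_const (ContinuousLinearMap.id ℝ (E n))) hAid hi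
    rw [hBdef, this]
    simp
  have hsymm : IsSymmSndFDerivWithinAt ℝ φ H z₀ := by
    refine hφ.isSymmSndFDerivWithinAt
      (by rw [minSmoothness_of_isRCLikeNormedField]; norm_num) hHu ?_ hzH
    rw [convex_halfSpace.closure_interior_eq_closure_of_nonempty_interior
      interior_halfSpace_nonempty]
    exact subset_closure hzH
  have hB0t : ∀ i : Fin n, i ≠ 0 →
      B z₀ (EuclideanSpace.single 0 1) (EuclideanSpace.single i 1) = 0 := fun i hi ↦ by
    have := hsymm (EuclideanSpace.single 0 1) (EuclideanSpace.single i 1)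
    rw [← hAdef, ← hBdef, hBt i hi] at this
    simpa using this
  -- With `A = id` and `B e₀ e_k = 0`, the equation on `(e₀, e_k)` has `k`-th component `Υ₀ = 0`.
  have hΥn : Υ z₀ (EuclideanSpace.single 0 1) = 0 := by
    have := congrArg (fun v : E n ↦ v k)
      (heq0 (EuclideanSpace.single 0 1) (EuclideanSpace.single k 1))
    rw [hB0t k hk, hA0, hΥ0 k hk] at this
    simpa using this
  refine clm_eq_of_basis fun i ↦ ?_
  by_cases hi : i = 0
  · subst hi
    refine clm_eq_of_basis fun j ↦ ?_
    by_cases hj : j = 0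
    · subst hj
      have := heq0 (EuclideanSpace.single 0 1) (EuclideanSpace.single 0 1)
      rw [hA0, hΥn] at this
      simpa using this
    · simpa using hB0t j hj
  · simpa using hBt i hi

end Boundary

/-! ### Differentiability of charts, coordinate fields and boundary points. -/

section Charts

variable {n : ℕ} [NeZero n] {M : Type*} [TopologicalSpace M]

lemma extend_apply_mem_range (e : OpenPartialHomeomorph M (EuclideanHalfSpace n)) (x : M) :
    e.extend (𝓡∂ n) x ∈ range (𝓡∂ n) := ⟨e x, rfl⟩

lemma extend_target_mem_nhdsWithin_range
    {e : OpenPartialHomeomorph M (EuclideanHalfSpace n)} {z : E n}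
    (hz : z ∈ (e.extend (𝓡∂ n)).target) :
    (e.extend (𝓡∂ n)).target ∈ 𝓝[range (𝓡∂ n)] z := by
  have h := (e.extend (𝓡∂ n)).map_target hz
  rw [e.extend_source] at h
  have := e.extend_target_mem_nhdsWithin (I := 𝓡∂ n) h
  rwa [(e.extend (𝓡∂ n)).right_inv hz] at this

variable [ChartedSpace (EuclideanHalfSpace n) M]

lemma mdifferentiableAt_extend_of_mem_maximalAtlas
    {e : OpenPartialHomeomorph M (EuclideanHalfSpace n)}
    (he : e ∈ IsManifold.maximalAtlas (𝓡∂ n) ω M) {x : M} (hx : x ∈ e.source) :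
    MDifferentiableAt (𝓡∂ n) 𝓘(ℝ, E n) (e.extend (𝓡∂ n)) x :=
  (e.contMDiffAt_extend he hx).mdifferentiableAt (by simp)

/-- Functions that are differentiable in coordinates. -/
lemma hasMFDerivAt_comp_extend
    {e : OpenPartialHomeomorph M (EuclideanHalfSpace n)}
    (he : e ∈ IsManifold.maximalAtlas (𝓡∂ n) ω M) {x : M} (hx : x ∈ e.source)
    {F : Type*} [NormedAddCommGroup F] [NormedSpace ℝ F] {g : E n → F} {g' : E n →L[ℝ] F}
    (hg : HasFDerivWithinAt g g' (range (𝓡∂ n)) (e.extend (𝓡∂ n) x)) :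
    HasMFDerivAt (𝓡∂ n) 𝓘(ℝ, F) (g ∘ e.extend (𝓡∂ n)) x (g'.comp (chartDifferential e x)) := by
  have h1 := (mdifferentiableAt_extend_of_mem_maximalAtlas he hx).hasMFDerivAt
  exact hasMFDerivWithinAt_univ.1 (hg.hasMFDerivWithinAt.comp x (hasMFDerivWithinAt_univ.2 h1)
    fun y _ ↦ extend_apply_mem_range e y)

lemma contMDiffWithinAt_extend_symm
    {e : OpenPartialHomeomorph M (EuclideanHalfSpace n)}
    (he : e ∈ IsManifold.maximalAtlas (𝓡∂ n) ω M) {z : E n}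
    (hz : z ∈ (e.extend (𝓡∂ n)).target) :
    ContMDiffWithinAt 𝓘(ℝ, E n) (𝓡∂ n) ω (e.extend (𝓡∂ n)).symm (range (𝓡∂ n)) z := by
  have := contMDiffOn_extend_symm he
  rw [← e.extend_target'] at this
  exact (this z hz).mono_of_mem_nhdsWithin (extend_target_mem_nhdsWithin_range hz)

lemma isInvertible_chartDifferential
    {e : OpenPartialHomeomorph M (EuclideanHalfSpace n)}
    (he : e ∈ IsManifold.maximalAtlas (𝓡∂ n) ω M) {x : M} (hx : x ∈ e.source) :
    (chartDifferential e x).IsInvertible := by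
  have he1 : e ∈ IsManifold.maximalAtlas (𝓡∂ n) 1 M :=
    IsManifold.maximalAtlas_subset_of_le (by simp) he
  have hd : e.MDifferentiable (𝓡∂ n) (𝓡∂ n) :=
    ⟨fun y hy ↦ (mdifferentiableAt_of_mem_maximalAtlas he1 hy).mdifferentiableWithinAt,
      fun y hy ↦ (mdifferentiableAt_symm_of_mem_maximalAtlas he1 hy).mdifferentiableWithinAt⟩
  have h : mfderiv (𝓡∂ n) 𝓘(ℝ, E n) (e.extend (𝓡∂ n)) x = mfderiv (𝓡∂ n) (𝓡∂ n) e x :=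
    (((𝓡∂ n).hasMFDerivAt (x := e x)).comp x (hd.mdifferentiableAt hx).hasMFDerivAt).mfderiv
  refine ⟨hd.mfderiv hx, ?_⟩
  exact h.symm

/-- Being an interior point does not depend on the chart: the differential of `e` is surjective, so
an interior point would be sent into the open half space. -/
lemma isBoundaryPoint_of_extend_apply_eq_zero
    {e : OpenPartialHomeomorph M (EuclideanHalfSpace n)}
    (he : e ∈ IsManifold.maximalAtlas (𝓡∂ n) ω M) {x : M} (hx : x ∈ e.source)
    (h0 : e.extend (𝓡∂ n) x 0 = 0) : x ∈ (𝓡∂ n).boundary M := by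
  rw [ModelWithCorners.boundary, mem_ofPred_eq,
    ModelWithCorners.isBoundaryPoint_iff_not_isInteriorPoint]
  intro hint
  have he1 : e ∈ IsManifold.maximalAtlas (𝓡∂ n) 1 M :=
    IsManifold.maximalAtlas_subset_of_le (by simp) he
  have hd : e.MDifferentiable (𝓡∂ n) (𝓡∂ n) :=
    ⟨fun y hy ↦ (mdifferentiableAt_of_mem_maximalAtlas he1 hy).mdifferentiableWithinAt,
      fun y hy ↦ (mdifferentiableAt_symm_of_mem_maximalAtlas he1 hy).mdifferentiableWithinAt⟩
  have := (hd.mdifferentiableAt hx).isInteriorPoint_of_surjective_mfderiv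
    (hd.mfderiv_surjective hx) hint
  have h1 : e.extend (𝓡∂ n) x ∈ interior (range (𝓡∂ n)) := this
  rw [interior_range_modelWithCornersEuclideanHalfSpace] at h1
  exact absurd h0 (ne_of_gt h1)

lemma chartDifferential_coordField
    {e : OpenPartialHomeomorph M (EuclideanHalfSpace n)}
    (he : e ∈ IsManifold.maximalAtlas (𝓡∂ n) ω M) {x : M} (hx : x ∈ e.source) (j : Fin n) :
    chartDifferential e x (coordField e j x) = EuclideanSpace.single j 1 :=
  (isInvertible_chartDifferential he hx).self_apply_inverse _

lemma fieldDifferentiableAt_coordField [IsManifold (𝓡∂ n) ω M]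
    {e : OpenPartialHomeomorph M (EuclideanHalfSpace n)}
    (he : e ∈ IsManifold.maximalAtlas (𝓡∂ n) ω M) {x : M} (hx : x ∈ e.source) (j : Fin n) :
    FieldDifferentiableAt (coordField e j) x := by
  have hc : MDifferentiableAt 𝓘(ℝ, E n) 𝓘(ℝ, E n).tangent
      (fun y : E n ↦ (⟨y, EuclideanSpace.single j (1 : ℝ)⟩ : TangentBundle 𝓘(ℝ, E n) (E n)))
      (e.extend (𝓡∂ n) x) :=
    (contMDiffAt_vectorSpace_iff_contDiffAt.2 (contDiffAt_const (n := 1))).mdifferentiableAt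
      one_ne_zero
  exact MDifferentiableAt.mpullback_vectorField (n := ω) hc (e.contMDiffAt_extend he hx)
    (isInvertible_chartDifferential he hx) le_top

end Charts

/-! ### From projective equivalence on the manifold to the equation in a chart. -/

section LocalExpressions

variable {n : ℕ} [NeZero n] {M : Type*} [TopologicalSpace M]
  [ChartedSpace (EuclideanHalfSpace n) M]

/-- The expression of a diffeomorphism in a chart. -/
def chartExpression (φ : M ≃ₘ⟮𝓡∂ n, 𝓡∂ n⟯ M)
    (e : OpenPartialHomeomorph M (EuclideanHalfSpace n)) (z : E n) : E n :=
  e.extend (𝓡∂ n) (φ ((e.extend (𝓡∂ n)).symm z))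

lemma contDiffWithinAt_chartExpression (φ : M ≃ₘ⟮𝓡∂ n, 𝓡∂ n⟯ M)
    {e : OpenPartialHomeomorph M (EuclideanHalfSpace n)}
    (he : e ∈ IsManifold.maximalAtlas (𝓡∂ n) ω M) {x : M} (hx : x ∈ e.source)
    (hφx : φ x ∈ e.source) :
    ContDiffWithinAt ℝ ∞ (chartExpression φ e) (range (𝓡∂ n)) (e.extend (𝓡∂ n) x) := by
  rw [← contMDiffWithinAt_iff_contDiffWithinAt]
  have hz : e.extend (𝓡∂ n) x ∈ (e.extend (𝓡∂ n)).target :=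
    (e.extend (𝓡∂ n)).map_source (by rwa [e.extend_source])
  have h1 := (contMDiffWithinAt_extend_symm he hz).of_le (m := ∞) le_top
  have h2 : ContMDiffAt (𝓡∂ n) (𝓡∂ n) ∞ φ ((e.extend (𝓡∂ n)).symm (e.extend (𝓡∂ n) x)) :=
    φ.contMDiffAt
  have h3 : ContMDiffAt (𝓡∂ n) 𝓘(ℝ, E n) ∞ (e.extend (𝓡∂ n))
      (φ ((e.extend (𝓡∂ n)).symm (e.extend (𝓡∂ n) x))) := by
    rw [e.extend_left_inv hx]
    exact (e.contMDiffAt_extend he hφx).of_le le_top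
  exact (h3.comp _ h2).comp_contMDiffWithinAt _ h1

lemma eventually_chartExpression_extend (φ : M ≃ₘ⟮𝓡∂ n, 𝓡∂ n⟯ M)
    {e : OpenPartialHomeomorph M (EuclideanHalfSpace n)} {x : M} (hx : x ∈ e.source) :
    (chartExpression φ e ∘ e.extend (𝓡∂ n)) =ᶠ[𝓝 x] (e.extend (𝓡∂ n) ∘ φ) := by
  filter_upwards [e.open_source.mem_nhds hx] with y hy
  simp only [chartExpression, Function.comp_apply, e.extend_left_inv hy]

lemma eq_sum_coordField {e : OpenPartialHomeomorph M (EuclideanHalfSpace n)}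
    (he : e ∈ IsManifold.maximalAtlas (𝓡∂ n) ω M) {x : M} (hx : x ∈ e.source)
    (v : TangentSpace (𝓡∂ n) x) :
    v = ∑ b, chartDifferential e x v b • coordField e b x := by
  have hinv := isInvertible_chartDifferential he hx
  have h : (chartDifferential e x).inverse (chartDifferential e x v) = v :=
    hinv.inverse_apply_self v
  conv_lhs => rw [← h, ← (EuclideanSpace.basisFun (Fin n) ℝ).sum_repr (chartDifferential e x v),
    map_sum]
  refine Finset.sum_congr rfl fun b _ ↦ ?_
  rw [map_smul]
  simp [coordField]

/-- The derivative of the chart expression of a diffeomorphism. -/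
lemma chartDifferential_mfderiv (φ : M ≃ₘ⟮𝓡∂ n, 𝓡∂ n⟯ M)
    {e : OpenPartialHomeomorph M (EuclideanHalfSpace n)}
    (he : e ∈ IsManifold.maximalAtlas (𝓡∂ n) ω M) {x : M} (hx : x ∈ e.source)
    (hφx : φ x ∈ e.source) (v : TangentSpace (𝓡∂ n) x) :
    chartDifferential e (φ x) (mfderiv (𝓡∂ n) (𝓡∂ n) φ x v) =
      fderivWithin ℝ (chartExpression φ e) (range (𝓡∂ n)) (e.extend (𝓡∂ n) x)
        (chartDifferential e x v) := by
  have h1 := hasMFDerivAt_comp_extend he hx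
    ((contDiffWithinAt_chartExpression φ he hx hφx).differentiableWithinAt
      (by simp)).hasFDerivWithinAt
  have h2 := (mdifferentiableAt_extend_of_mem_maximalAtlas he hφx).hasMFDerivAt.comp x
    (φ.mdifferentiable (by simp) x).hasMFDerivAt
  have h3 := hasMFDerivAt_unique h2
    (h1.congr_of_eventuallyEq (eventually_chartExpression_extend φ hx).symm)
  exact congrArg (fun L : E n →L[ℝ] E n ↦ L v) h3

/-- The components of the push-forward of a coordinate field. -/
def pushforwardComponent (φ : M ≃ₘ⟮𝓡∂ n, 𝓡∂ n⟯ M)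
    (e : OpenPartialHomeomorph M (EuclideanHalfSpace n)) (j b : Fin n) (y : M) : ℝ :=
  fderivWithin ℝ (chartExpression φ e) (range (𝓡∂ n)) (e.extend (𝓡∂ n) (φ.symm y))
    (EuclideanSpace.single j 1) b

/-- Composing with `φ` cancels `φ.symm` and leaves an entry of the first derivative in the chart;
the chain rule then produces the second derivative. -/
lemma mvfderiv_pushforwardComponent (φ : M ≃ₘ⟮𝓡∂ n, 𝓡∂ n⟯ M)
    {e : OpenPartialHomeomorph M (EuclideanHalfSpace n)}
    (he : e ∈ IsManifold.maximalAtlas (𝓡∂ n) ω M) {x : M} (hx : x ∈ e.source)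
    (hφx : φ x ∈ e.source) (j b : Fin n) :
    MDifferentiableAt (𝓡∂ n) 𝓘(ℝ, ℝ) (pushforwardComponent φ e j b) (φ x) ∧
      ∀ v, mvfderiv (𝓡∂ n) (pushforwardComponent φ e j b) (φ x) (mfderiv (𝓡∂ n) (𝓡∂ n) φ x v) =
        fderivWithin ℝ (fderivWithin ℝ (chartExpression φ e) (range (𝓡∂ n))) (range (𝓡∂ n))
          (e.extend (𝓡∂ n) x) (chartDifferential e x v) (EuclideanSpace.single j 1) b := by
  set A := fderivWithin ℝ (chartExpression φ e) (range (𝓡∂ n)) with hA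
  have hd : DifferentiableWithinAt ℝ A (range (𝓡∂ n)) (e.extend (𝓡∂ n) x) :=
    ((contDiffWithinAt_chartExpression φ he hx hφx).fderivWithin_right (m := 1)
      (𝓡∂ n).uniqueDiffOn (by norm_cast) (extend_apply_mem_range e x)).differentiableWithinAt
        one_ne_zero
  have h1 : HasFDerivWithinAt (fun z ↦ A z (EuclideanSpace.single j 1) b)
      ((EuclideanSpace.proj b : E n →L[ℝ] ℝ).comp
        ((fderivWithin ℝ A (range (𝓡∂ n)) (e.extend (𝓡∂ n) x)).flip (EuclideanSpace.single j 1)))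
      (range (𝓡∂ n)) (e.extend (𝓡∂ n) x) :=
    (EuclideanSpace.proj b : E n →L[ℝ] ℝ).hasFDerivAt.comp_hasFDerivWithinAt _
      (hasFDerivWithinAt_eval hd.hasFDerivWithinAt (EuclideanSpace.single j 1))
  have h2 := hasMFDerivAt_comp_extend he hx h1
  have h3 : MDifferentiableAt (𝓡∂ n) 𝓘(ℝ, ℝ) (pushforwardComponent φ e j b) (φ x) := by
    have h4 := h2.mdifferentiableAt
    have hx' : φ.symm (φ x) = x := φ.symm_apply_apply x
    rw [← hx'] at h4
    exact h4.comp (φ x) (φ.symm.mdifferentiable (by simp) (φ x))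
  refine ⟨h3, fun v ↦ ?_⟩
  have h5 := h3.hasMFDerivAt.comp x (φ.mdifferentiable (by simp) x).hasMFDerivAt
  have h6 : pushforwardComponent φ e j b ∘ φ =
      (fun z ↦ A z (EuclideanSpace.single j 1) b) ∘ e.extend (𝓡∂ n) := by
    ext y
    simp only [Function.comp_apply, pushforwardComponent, φ.symm_apply_apply, hA]
  rw [h6] at h5
  exact congrArg (fun L : E n →L[ℝ] ℝ ↦ L v) (hasMFDerivAt_unique h5 h2)

lemma pushforward_coordField_eventuallyEq (φ : M ≃ₘ⟮𝓡∂ n, 𝓡∂ n⟯ M)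
    {e : OpenPartialHomeomorph M (EuclideanHalfSpace n)}
    (he : e ∈ IsManifold.maximalAtlas (𝓡∂ n) ω M) {x : M} (hx : x ∈ e.source)
    (hφx : φ x ∈ e.source) (j : Fin n) :
    ∀ᶠ y in 𝓝 (φ x), pushforward φ (coordField e j) y =
      ∑ b, pushforwardComponent φ e j b y • coordField e b y := by
  have hs : ∀ᶠ y in 𝓝 (φ x), φ.symm y ∈ e.source := by
    refine φ.symm.continuous.continuousAt.eventually_mem (e.open_source.mem_nhds ?_)
    rwa [φ.symm_apply_apply]
  filter_upwards [hs, e.open_source.mem_nhds hφx] with y h1 h2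
  obtain ⟨x', rfl⟩ : ∃ x', φ x' = y := ⟨φ.symm y, φ.apply_symm_apply y⟩
  rw [φ.symm_apply_apply] at h1
  rw [pushforward_apply, eq_sum_coordField he h2 (mfderiv (𝓡∂ n) (𝓡∂ n) φ x' (coordField e j x'))]
  refine Finset.sum_congr rfl fun b _ ↦ ?_
  rw [chartDifferential_mfderiv φ he h1 h2, chartDifferential_coordField he h1,
    pushforwardComponent, φ.symm_apply_apply]

variable [IsManifold (𝓡∂ n) ω M]

/-- The Christoffel symbols of a connection in a chart, as a bilinear map. -/
def christoffelMap (cov : AffineConnection n M)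
    (e : OpenPartialHomeomorph M (EuclideanHalfSpace n)) (z : E n) : E n →L[ℝ] E n →L[ℝ] E n :=
  ∑ k, (EuclideanSpace.proj k : E n →L[ℝ] ℝ).smulRight
    (∑ j, (EuclideanSpace.proj j : E n →L[ℝ] ℝ).smulRight
      (∑ i, christoffel cov e i j k ((e.extend (𝓡∂ n)).symm z) •
        (EuclideanSpace.single i 1 : E n)))

lemma christoffelMap_single (cov : AffineConnection n M)
    (e : OpenPartialHomeomorph M (EuclideanHalfSpace n)) (z : E n) (i j k : Fin n) :
    christoffelMap cov e z (EuclideanSpace.single k 1) (EuclideanSpace.single j 1) i =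
      christoffel cov e i j k ((e.extend (𝓡∂ n)).symm z) := by
  simp [christoffelMap, Finset.sum_apply, Pi.single_apply]

lemma contDiffWithinAt_christoffelMap {cov : AffineConnection n M} (hcov : IsAnalyticConnection cov)
    {e : OpenPartialHomeomorph M (EuclideanHalfSpace n)}
    (he : e ∈ IsManifold.maximalAtlas (𝓡∂ n) ω M) {z : E n}
    (hz : z ∈ (e.extend (𝓡∂ n)).target) :
    ContDiffWithinAt ℝ ω (christoffelMap cov e) (range (𝓡∂ n)) z := by
  refine ContDiffWithinAt.sum fun k _ ↦ contDiffWithinAt_const.smulRight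
    (ContDiffWithinAt.sum fun j _ ↦ contDiffWithinAt_const.smulRight
      (ContDiffWithinAt.sum fun i _ ↦ ContDiffWithinAt.fun_smul ?_ contDiffWithinAt_const))
  exact (hcov e he i j k z hz).mono_of_mem_nhdsWithin (extend_target_mem_nhdsWithin_range hz)

/-- In `christoffelMap` the first slot is the direction and the second the field. By linearity in
`v`, coordinate directions suffice. -/
lemma chartDifferential_cov_coordField (cov : AffineConnection n M)
    {e : OpenPartialHomeomorph M (EuclideanHalfSpace n)}
    (he : e ∈ IsManifold.maximalAtlas (𝓡∂ n) ω M) {x : M} (hx : x ∈ e.source) (j : Fin n)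
    (v : TangentSpace (𝓡∂ n) x) :
    chartDifferential e x (cov (coordField e j) x v) =
      christoffelMap cov e (e.extend (𝓡∂ n) x) (chartDifferential e x v)
        (EuclideanSpace.single j 1) := by
  have hinv := isInvertible_chartDifferential he hx
  have key : ((chartDifferential e x).comp (cov (coordField e j) x)).comp
      (chartDifferential e x).inverse =
      (christoffelMap cov e (e.extend (𝓡∂ n) x)).flip (EuclideanSpace.single j 1) := by
    refine clm_eq_of_basis fun k ↦ ?_
    ext i
    refine Eq.trans ?_ (christoffelMap_single cov e _ i j k).symm
    rw [e.extend_left_inv hx]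
    rfl
  have := congrArg (fun L : E n →L[ℝ] E n ↦ L (chartDifferential e x v)) key
  refine Eq.trans ?_ this
  change _ = chartDifferential e x (cov (coordField e j) x
    ((chartDifferential e x).inverse (chartDifferential e x v)))
  rw [hinv.inverse_apply_self]

lemma fieldDifferentiableAt_sum {ι : Type*} (s : Finset ι) {f : ι → M → ℝ}
    {Y : ι → Π x : M, TangentSpace (𝓡∂ n) x} {x : M}
    (hf : ∀ b, MDifferentiableAt (𝓡∂ n) 𝓘(ℝ, ℝ) (f b) x)
    (hY : ∀ b, FieldDifferentiableAt (Y b) x) :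
    FieldDifferentiableAt (fun y ↦ ∑ b ∈ s, f b y • Y b y) x :=
  MDifferentiableAt.sum_section fun b _ ↦ MDifferentiableAt.smul_section (hf b) (hY b)

lemma cov_sum (cov : AffineConnection n M) {ι : Type*} (s : Finset ι) {f : ι → M → ℝ}
    {Y : ι → Π x : M, TangentSpace (𝓡∂ n) x} {x : M}
    (hf : ∀ b, MDifferentiableAt (𝓡∂ n) 𝓘(ℝ, ℝ) (f b) x)
    (hY : ∀ b, FieldDifferentiableAt (Y b) x) (v : TangentSpace (𝓡∂ n) x) :
    cov (fun y ↦ ∑ b ∈ s, f b y • Y b y) x v =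
      ∑ b ∈ s, (f b x • cov (Y b) x v + mvfderiv (𝓡∂ n) (f b) x v • Y b x) := by
  classical
  induction s using Finset.induction_on with
  | empty =>
    have h : (fun y ↦ ∑ b ∈ (∅ : Finset ι), f b y • Y b y) = 0 := rfl
    rw [h, cov.isCovariantDerivativeOnUniv.zero]
    rfl
  | insert a s ha ih =>
    have h : (fun y ↦ ∑ b ∈ insert a s, f b y • Y b y) =
        f a • Y a + fun y ↦ ∑ b ∈ s, f b y • Y b y := by
      funext y
      rw [Finset.sum_insert ha]
      rfl
    rw [h, Finset.sum_insert ha, ← ih, cov.isCovariantDerivativeOnUniv.add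
      (MDifferentiableAt.smul_section (hf a) (hY a)) (fieldDifferentiableAt_sum s hf hY),
      cov.isCovariantDerivativeOnUniv.leibniz (hY a) (hf a)]
    rfl

/-- A projective transformation satisfies the projective equation in every chart. -/
theorem exists_projectiveEquationAt {cov : AffineConnection n M} {φ : M ≃ₘ⟮𝓡∂ n, 𝓡∂ n⟯ M}
    (h : ProjectivelyEquivalent cov (pullback φ cov))
    {e : OpenPartialHomeomorph M (EuclideanHalfSpace n)}
    (he : e ∈ IsManifold.maximalAtlas (𝓡∂ n) ω M) :
    ∃ Υ : E n → E n →L[ℝ] ℝ, ∀ x ∈ e.source, φ x ∈ e.source →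
      ProjectiveEquationAt (range (𝓡∂ n)) (christoffelMap cov e) (chartExpression φ e)
        (Υ (e.extend (𝓡∂ n) x)) (e.extend (𝓡∂ n) x) := by
  classical
  -- The one-form may be chosen point by point, since its smoothness is recovered from the equation.
  suffices h' : ∀ x ∈ e.source, φ x ∈ e.source → ∃ Υ : E n →L[ℝ] ℝ,
      ProjectiveEquationAt (range (𝓡∂ n)) (christoffelMap cov e) (chartExpression φ e) Υ
        (e.extend (𝓡∂ n) x) by
    refine ⟨fun z ↦ if h : ∃ Υ : E n →L[ℝ] ℝ, ProjectiveEquationAt (range (𝓡∂ n))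
      (christoffelMap cov e) (chartExpression φ e) Υ z then h.choose else 0, fun x hx hφx ↦ ?_⟩
    beta_reduce
    rw [dif_pos (h' x hx hφx)]
    exact (h' x hx hφx).choose_spec
  intro x hx hφx
  obtain ⟨Υ, hΥ⟩ := h
  refine ⟨(Υ x).comp (chartDifferential e x).inverse, ?_⟩
  have hinv := isInvertible_chartDifferential he hx
  set z := e.extend (𝓡∂ n) x with hz
  set C := chartDifferential e x with hC
  set A := fderivWithin ℝ (chartExpression φ e) (range (𝓡∂ n)) with hA
  have hφz : chartExpression φ e z = e.extend (𝓡∂ n) (φ x) := by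
    rw [chartExpression, hz, e.extend_left_inv hx]
  have key : ∀ (j : Fin n) (v : TangentSpace (𝓡∂ n) x),
      fderivWithin ℝ A (range (𝓡∂ n)) z (C v) (EuclideanSpace.single j 1) +
        christoffelMap cov e (chartExpression φ e z) (A z (C v))
          (A z (EuclideanSpace.single j 1)) =
      A z (christoffelMap cov e z (C v) (EuclideanSpace.single j 1)) +
        Υ x v • A z (EuclideanSpace.single j 1) + Υ x (coordField e j x) • A z (C v) := by
    intro j v
    have hfd := fieldDifferentiableAt_coordField he hx j
    have h1 := hΥ x (coordField e j) hfd v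
    -- The frame expansion holds only near `φ x`; locality of the connection makes this enough.
    have hcongr : cov (pushforward φ (coordField e j)) (φ x) =
        cov (fun y ↦ ∑ b, pushforwardComponent φ e j b y • coordField e b y) (φ x) :=
      cov.isCovariantDerivativeOnUniv.congr_of_eventuallyEq
        (fieldDifferentiableAt_pushforward φ hfd)
        (fieldDifferentiableAt_sum _ (fun b ↦ (mvfderiv_pushforwardComponent φ he hx hφx j b).1)
          fun b ↦ fieldDifferentiableAt_coordField he hφx b) univ_mem
        (pushforward_coordField_eventuallyEq φ he hx hφx j)
    have hpull : mfderiv (𝓡∂ n) (𝓡∂ n) φ x (pullback φ cov (coordField e j) x v) =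
        cov (pushforward φ (coordField e j)) (φ x) (mfderiv (𝓡∂ n) (𝓡∂ n) φ x v) :=
      (isInvertible_mfderiv φ x).self_apply_inverse _
    -- Leibniz rule: differentiating the coefficients gives the second derivative of `φ`,
    -- differentiating the frame gives the Christoffel term at `φ x`.
    have hl : chartDifferential e (φ x) (mfderiv (𝓡∂ n) (𝓡∂ n) φ x
        (pullback φ cov (coordField e j) x v)) =
        ∑ b, (A z (EuclideanSpace.single j 1) b •
          christoffelMap cov e (chartExpression φ e z) (A z (C v)) (EuclideanSpace.single b 1) +
          fderivWithin ℝ A (range (𝓡∂ n)) z (C v) (EuclideanSpace.single j 1) b •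
            EuclideanSpace.single b (1 : ℝ)) := by
      rw [hpull, hcongr, cov_sum cov _
        (fun b ↦ (mvfderiv_pushforwardComponent φ he hx hφx j b).1)
        (fun b ↦ fieldDifferentiableAt_coordField he hφx b), map_sum]
      refine Finset.sum_congr rfl fun b _ ↦ ?_
      rw [map_add, map_smul, map_smul, chartDifferential_cov_coordField cov he hφx,
        chartDifferential_coordField he hφx, chartDifferential_mfderiv φ he hx hφx,
        (mvfderiv_pushforwardComponent φ he hx hφx j b).2, pushforwardComponent,
        φ.symm_apply_apply, hφz]
    have hr : C (cov (coordField e j) x v + Υ x v • coordField e j x +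
        Υ x (coordField e j x) • v) =
        christoffelMap cov e z (C v) (EuclideanSpace.single j 1) +
          Υ x v • EuclideanSpace.single j (1 : ℝ) + Υ x (coordField e j x) • C v := by
      rw [map_add, map_add, map_smul, map_smul, hC, chartDifferential_cov_coordField cov he hx,
        chartDifferential_coordField he hx]
    have h2 : chartDifferential e (φ x) (mfderiv (𝓡∂ n) (𝓡∂ n) φ x
        (pullback φ cov (coordField e j) x v)) =
        A z (christoffelMap cov e z (C v) (EuclideanSpace.single j 1)) +
        Υ x v • A z (EuclideanSpace.single j 1) + Υ x (coordField e j x) • A z (C v) := by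
      rw [← map_smul, ← map_smul, ← map_add, ← map_add, ← hr, ← h1]
      exact chartDifferential_mfderiv φ he hx hφx _
    rw [← h2, hl, Finset.sum_add_distrib, add_comm]
    congr 1
    · conv_lhs => rw [← (EuclideanSpace.basisFun (Fin n) ℝ).sum_repr
        (A z (EuclideanSpace.single j 1)), map_sum]
      simp
    · conv_lhs => rw [← (EuclideanSpace.basisFun (Fin n) ℝ).sum_repr
        (fderivWithin ℝ A (range (𝓡∂ n)) z (C v) (EuclideanSpace.single j 1))]
      simp
  intro u w
  obtain ⟨v, rfl⟩ : ∃ v, C v = u := ⟨C.inverse u, hinv.self_apply_inverse u⟩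
  have h1 : fderivWithin ℝ A (range (𝓡∂ n)) z (C v) +
        (christoffelMap cov e (chartExpression φ e z) (A z (C v))).comp (A z) =
      (A z).comp (christoffelMap cov e z (C v)) + Υ x v • A z +
        ((Υ x).comp C.inverse).smulRight (A z (C v)) := by
    refine clm_eq_of_basis fun j ↦ ?_
    exact key j v
  have h2 := congrArg (fun L : E n →L[ℝ] E n ↦ L w) h1
  have h3 : ((Υ x).comp C.inverse) (C v) = Υ x v :=
    congrArg (Υ x) (hinv.inverse_apply_self v)
  rw [h3]
  exact h2

end LocalExpressions

/-! ### Local triviality at the given boundary point and its propagation. -/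

section Rigidity

variable {n : ℕ} [NeZero n] {M : Type*} [TopologicalSpace M]

lemma eventually_nhdsWithin_range_iff {e : OpenPartialHomeomorph M (EuclideanHalfSpace n)} {x : M}
    (hx : x ∈ e.source) {p : E n → Prop} :
    (∀ᶠ z in 𝓝[range (𝓡∂ n)] (e.extend (𝓡∂ n) x), p z) ↔
      ∀ᶠ y in 𝓝 x, p (e.extend (𝓡∂ n) y) := by
  rw [← e.map_extend_nhds hx, eventually_map]

variable [ChartedSpace (EuclideanHalfSpace n) M]

lemma eventually_mem_source {e : OpenPartialHomeomorph M (EuclideanHalfSpace n)}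
    (φ : M ≃ₘ⟮𝓡∂ n, 𝓡∂ n⟯ M) {x : M} (hx : x ∈ e.source) (hφx : φ x ∈ e.source) :
    ∀ᶠ y in 𝓝 x, y ∈ e.source ∧ φ y ∈ e.source :=
  (show ∀ᶠ y in 𝓝 x, y ∈ e.source from e.open_source.mem_nhds hx).and
    (φ.continuous.continuousAt.eventually_mem (e.open_source.mem_nhds hφx))

variable [IsManifold (𝓡∂ n) ω M]

/-- A projective transformation with trivial second order jet at a point is trivial near it. -/
theorem eventually_fixed_of_jet_eq (hn : 2 ≤ n) {cov : AffineConnection n M}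
    (hcov : IsAnalyticConnection cov) {φ : M ≃ₘ⟮𝓡∂ n, 𝓡∂ n⟯ M}
    (h : ProjectivelyEquivalent cov (pullback φ cov))
    {e : OpenPartialHomeomorph M (EuclideanHalfSpace n)}
    (he : e ∈ IsManifold.maximalAtlas (𝓡∂ n) ω M) {x : M} (hx : x ∈ e.source) (hφx : φ x = x)
    (hA : fderivWithin ℝ (chartExpression φ e) (range (𝓡∂ n)) (e.extend (𝓡∂ n) x) =
      ContinuousLinearMap.id ℝ (E n))
    (hB : fderivWithin ℝ (fderivWithin ℝ (chartExpression φ e) (range (𝓡∂ n))) (range (𝓡∂ n))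
      (e.extend (𝓡∂ n) x) = 0) :
    ∀ᶠ y in 𝓝 x, φ y = y := by
  have hφs : φ x ∈ e.source := by rwa [hφx]
  obtain ⟨Υ, hΥ⟩ := exists_projectiveEquationAt h he
  have htar : e.extend (𝓡∂ n) x ∈ (e.extend (𝓡∂ n)).target :=
    (e.extend (𝓡∂ n)).map_source (by rwa [e.extend_source])
  have key := eventually_eq_self_of_projectiveEquation hn (𝓡∂ n).convex_range
    (𝓡∂ n).nonempty_interior (extend_apply_mem_range e x)
    ((contDiffWithinAt_christoffelMap hcov he htar).of_le le_top)
    ((contDiffWithinAt_chartExpression φ he hx hφs).of_le (by norm_cast))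
    (.of_forall fun z ↦ extend_apply_mem_range e _)
    (by rw [chartExpression, e.extend_left_inv hx, hφx]) hA hB (Υ := Υ)
    ((eventually_nhdsWithin_range_iff hx).2
      ((eventually_mem_source φ hx hφs).mono fun y hy ↦ hΥ y hy.1 hy.2))
  rw [eventually_nhdsWithin_range_iff hx] at key
  filter_upwards [key, eventually_mem_source φ hx hφs] with y h1 h2
  rw [chartExpression, e.extend_left_inv h2.1] at h1
  exact (e.extend (𝓡∂ n)).injOn (by rw [e.extend_source]; exact h2.2)
    (by rw [e.extend_source]; exact h2.1) h1

/-- The set of points near which a projective transformation is trivial is closed. -/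
theorem isClosed_setOf_eventually_fixed [T2Space M] (hn : 2 ≤ n) {cov : AffineConnection n M}
    (hcov : IsAnalyticConnection cov) {φ : M ≃ₘ⟮𝓡∂ n, 𝓡∂ n⟯ M}
    (h : ProjectivelyEquivalent cov (pullback φ cov)) :
    IsClosed {x : M | ∀ᶠ y in 𝓝 x, φ y = y} := by
  set S := {x : M | ∀ᶠ y in 𝓝 x, φ y = y} with hS
  refine isClosed_of_closure_subset fun x hxS ↦ ?_
  have hSφ : S ⊆ {y | φ y = y} := fun y hy ↦ Eventually.self_of_nhds hy
  have hφx : φ x = x :=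
    (isClosed_eq φ.continuous continuous_id).closure_subset_iff.2 hSφ hxS
  set e := chartAt (EuclideanHalfSpace n) x
  have he : e ∈ IsManifold.maximalAtlas (𝓡∂ n) ω M := IsManifold.chart_mem_maximalAtlas x
  have hx : x ∈ e.source := mem_chart_source _ x
  have hφs : φ x ∈ e.source := by rwa [hφx]
  set A := fderivWithin ℝ (chartExpression φ e) (range (𝓡∂ n)) with hA
  have hu : UniqueDiffOn ℝ (range (𝓡∂ n)) := (𝓡∂ n).uniqueDiffOn
  have hmem := extend_apply_mem_range e
  have cA : ContDiffWithinAt ℝ 1 A (range (𝓡∂ n)) (e.extend (𝓡∂ n) x) :=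
    (contDiffWithinAt_chartExpression φ he hx hφs).fderivWithin_right hu
      (by norm_cast) (hmem x)
  have cB : ContDiffWithinAt ℝ 0 (fderivWithin ℝ A (range (𝓡∂ n))) (range (𝓡∂ n))
      (e.extend (𝓡∂ n) x) := cA.fderivWithin_right hu (by norm_num) (hmem x)
  -- The identity holds near `y`, not only at it, so `A` and its derivative are both trivial at `y`;
  -- continuity carries this to the limit point `x`.
  have hSA : ∀ y ∈ S, y ∈ e.source →
      ∀ᶠ z in 𝓝[range (𝓡∂ n)] (e.extend (𝓡∂ n) y), A z = ContinuousLinearMap.id ℝ (E n) := by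
    intro y hy hys
    have h1 : ∀ᶠ z in 𝓝[range (𝓡∂ n)] (e.extend (𝓡∂ n) y), chartExpression φ e z = z := by
      rw [eventually_nhdsWithin_range_iff hys]
      filter_upwards [e.open_source.mem_nhds hys, hy] with y' h1 h2
      rw [chartExpression, e.extend_left_inv h1, h2]
    filter_upwards [eventually_eventually_nhdsWithin.2 h1, self_mem_nhdsWithin] with z h2 h3
    rw [hA, Filter.EventuallyEq.fderivWithin_eq (f := id) h2 (h2.self_of_nhdsWithin h3),
      fderivWithin_id (hu z h3)]
  have : (𝓝[S] x).NeBot := mem_closure_iff_nhdsWithin_neBot.1 hxS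
  have hlim : Tendsto (e.extend (𝓡∂ n)) (𝓝[S] x) (𝓝[range (𝓡∂ n)] (e.extend (𝓡∂ n) x)) := by
    rw [← e.map_extend_nhds hx]
    exact tendsto_map.mono_left nhdsWithin_le_nhds
  have hev : ∀ᶠ y in 𝓝[S] x, y ∈ S ∧ y ∈ e.source :=
    eventually_mem_nhdsWithin.and (nhdsWithin_le_nhds (e.open_source.mem_nhds hx))
  refine eventually_fixed_of_jet_eq hn hcov h he hx hφx ?_ ?_
  · refine tendsto_nhds_unique_of_eventuallyEq (cA.continuousWithinAt.tendsto.comp hlim)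
      (tendsto_const_nhds (x := ContinuousLinearMap.id ℝ (E n))) ?_
    filter_upwards [hev] with y hy
    exact (hSA y hy.1 hy.2).self_of_nhdsWithin (hmem y)
  · refine tendsto_nhds_unique_of_eventuallyEq (cB.continuousWithinAt.tendsto.comp hlim)
      (tendsto_const_nhds (x := (0 : E n →L[ℝ] E n →L[ℝ] E n))) ?_
    filter_upwards [hev] with y hy
    have h1 := hSA y hy.1 hy.2
    rw [Function.comp_apply, Filter.EventuallyEq.fderivWithin_eq
      (f := fun _ ↦ ContinuousLinearMap.id ℝ (E n)) h1 (h1.self_of_nhdsWithin (hmem y))]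
    simp

/-- If the connection form `α⁰_ν` is not a multiple of `dr`, then it has a nonzero tangential
component. -/
lemma exists_christoffel_ne_zero {cov : AffineConnection n M}
    {e : OpenPartialHomeomorph M (EuclideanHalfSpace n)}
    (he : e ∈ IsManifold.maximalAtlas (𝓡∂ n) ω M) {x : M} (hx : x ∈ e.source) {ν : Fin n}
    (h : connectionForm cov e 0 ν x ∉ Submodule.span ℝ {coordDifferential e 0 x}) :
    ∃ k : Fin n, k ≠ 0 ∧ christoffel cov e 0 ν k x ≠ 0 := by
  by_contra! hc
  -- If all tangential components vanish, then `α⁰_ν` is its value on `∂/∂r` times `dr`.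
  refine h (Submodule.mem_span_singleton.2 ⟨christoffel cov e 0 ν 0 x, ?_⟩)
  ext v
  have hv := eq_sum_coordField he hx v
  have h1 : connectionForm cov e 0 ν x v =
      ∑ b, chartDifferential e x v b * christoffel cov e 0 ν b x := by
    conv_lhs => rw [hv]
    rw [map_sum]
    refine Finset.sum_congr rfl fun b _ ↦ ?_
    rw [map_smul]
    rfl
  rw [h1, Finset.sum_eq_single 0 (fun b _ hb ↦ by rw [hc b hb, mul_zero])
    (fun h ↦ absurd (Finset.mem_univ _) h), mul_comm]
  rfl

/-- A projective transformation fixing the boundary is trivial near the boundary points where the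
second fundamental form of the boundary does not vanish. -/
theorem eventually_fixed_of_boundary_fixed (hn : 2 ≤ n) {cov : AffineConnection n M}
    (hcov : IsAnalyticConnection cov) {φ : M ≃ₘ⟮𝓡∂ n, 𝓡∂ n⟯ M}
    (h : ProjectivelyEquivalent cov (pullback φ cov))
    (hfix : ∀ x ∈ (𝓡∂ n).boundary M, φ x = x)
    {e : OpenPartialHomeomorph M (EuclideanHalfSpace n)}
    (he : e ∈ IsManifold.maximalAtlas (𝓡∂ n) ω M) {x : M} (hx : x ∈ e.source)
    (hx0 : e.extend (𝓡∂ n) x 0 = 0) {ν : Fin n} (hν : ν ≠ 0)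
    (hform : connectionForm cov e 0 ν x ∉ Submodule.span ℝ {coordDifferential e 0 x}) :
    ∀ᶠ y in 𝓝 x, φ y = y := by
  have hφx : φ x = x := hfix x (isBoundaryPoint_of_extend_apply_eq_zero he hx hx0)
  have hφs : φ x ∈ e.source := by rwa [hφx]
  have htar : e.extend (𝓡∂ n) x ∈ (e.extend (𝓡∂ n)).target :=
    (e.extend (𝓡∂ n)).map_source (by rwa [e.extend_source])
  obtain ⟨Υ, hΥ⟩ := exists_projectiveEquationAt h he
  obtain ⟨k, hk, hG⟩ := exists_christoffel_ne_zero he hx hform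
  have hr := range_modelWithCornersEuclideanHalfSpace n
  have hproj : ∀ᶠ z in 𝓝[range (𝓡∂ n)] (e.extend (𝓡∂ n) x), ProjectiveEquationAt
      (range (𝓡∂ n)) (christoffelMap cov e) (chartExpression φ e) (Υ z) z :=
    (eventually_nhdsWithin_range_iff hx).2
      ((eventually_mem_source φ hx hφs).mono fun y hy ↦ hΥ y hy.1 hy.2)
  have hid : ∀ᶠ z in 𝓝[{z : E n | z 0 = 0}] (e.extend (𝓡∂ n) x), chartExpression φ e z = z := by
    have hle : 𝓝[{z : E n | z 0 = 0}] (e.extend (𝓡∂ n) x) ≤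
        𝓝[range (𝓡∂ n)] (e.extend (𝓡∂ n) x) := by
      rw [hr]
      exact nhdsWithin_mono _ fun z (hz : z 0 = 0) ↦ hz.ge
    filter_upwards [hle (extend_target_mem_nhdsWithin_range htar), self_mem_nhdsWithin]
      with z h1 h2
    have hs := (e.extend (𝓡∂ n)).map_target h1
    have hinv := (e.extend (𝓡∂ n)).right_inv h1
    rw [e.extend_source] at hs
    rw [chartExpression, hfix _ (isBoundaryPoint_of_extend_apply_eq_zero he hs
      (by rw [hinv]; exact h2)), hinv]
  have c1 := (contDiffWithinAt_christoffelMap hcov he htar).continuousWithinAt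
  have c2 := (contDiffWithinAt_chartExpression φ he hx hφs).of_le (m := 3)
    (by norm_cast)
  have hG' : christoffelMap cov e (e.extend (𝓡∂ n) x) (EuclideanSpace.single k 1)
      (EuclideanSpace.single ν 1) 0 ≠ 0 := by
    rwa [christoffelMap_single, e.extend_left_inv hx]
  have key : fderivWithin ℝ (chartExpression φ e) (range (𝓡∂ n)) (e.extend (𝓡∂ n) x) =
      ContinuousLinearMap.id ℝ (E n) ∧
      fderivWithin ℝ (fderivWithin ℝ (chartExpression φ e) (range (𝓡∂ n))) (range (𝓡∂ n))
      (e.extend (𝓡∂ n) x) = 0 := by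
    rw [hr] at c1 c2 hproj ⊢
    exact jet_eq_of_boundary_fixed hx0 c1 c2 hid hproj hk hν hG'
  exact eventually_fixed_of_jet_eq hn hcov h he hx hφx key.1 key.2

end Rigidity

end ProjBoundary
end

theorem theorem1 {n : ℕ} [NeZero n] (hn : 2 ≤ n)
    {M : Type*} [TopologicalSpace M] [T2Space M] [ConnectedSpace M]
    [ChartedSpace (EuclideanHalfSpace n) M] [IsManifold (𝓡∂ n) ω M]
    (P : ProjBoundary.AnalyticProjectiveStructure n M)
    (h : ∃ p ∈ (𝓡∂ n).boundary M, ∃ α ∈ P.connections,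
      ∃ e ∈ IsManifold.maximalAtlas (𝓡∂ n) ω M, p ∈ e.source ∧ e.extend (𝓡∂ n) p = 0 ∧
        ∃ ν : Fin n, ν ≠ 0 ∧
          ProjBoundary.connectionForm α e 0 ν p ∉
            Submodule.span ℝ {ProjBoundary.coordDifferential e 0 p}) :
    ProjBoundary.BoundaryRigid P := by
  obtain ⟨p, -, α, hα, e, he, hp, hp0, ν, hν, hform⟩ := h
  intro φ hφ hfix
  have hpe := hφ α hα
  have hα' := P.analytic α hα
  have hopen : IsOpen {x : M | ∀ᶠ y in 𝓝 x, φ y = y} := isOpen_setOfPred_eventually_nhds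
  -- Connectedness enters here: the set is clopen and contains `p`.
  have huniv := IsClopen.eq_univ
    ⟨ProjBoundary.isClosed_setOf_eventually_fixed hn hα' hpe, hopen⟩
    ⟨p, ProjBoundary.eventually_fixed_of_boundary_fixed hn hα' hpe hfix he hp
      (by rw [hp0]; rfl) hν hform⟩
  refine Diffeomorph.ext fun x ↦ ?_
  have hx : x ∈ {x : M | ∀ᶠ y in 𝓝 x, φ y = y} := huniv ▸ mem_univ x
  exact Filter.Eventually.self_of_nhds (p := fun y ↦ φ y = y) hx
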